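/- Let $(\mathsf G,\oplus,0)$ be a topologically enriched monoidal groupoid. Quillen's bracket construction $\langle\mathsf G,\mathsf G\rangle$ is the topologically enriched category with the objects of $\mathsf G$, whose morphisms $A\to B$ are the classes $[X,f]$ of pairs consisting of $X\in\mathsf G$ and $f\colon X\oplus A\to B$ in $\mathsf G$, where $(X,f)\sim(X',f')$ if $f=f'\circ(g\oplus A)$ for some $g\colon X\to X'$ in $\mathsf G$; composition is $[Y,g]\circ[X,f]=[Y\oplus X,\,g\circ(Y\oplus f)]$, the identity of $A$ is $[0,\,0\oplus A\cong A]$, and the morphism spaces carry the topology of $\operatorname{colim}_{X\in\mathsf G}\operatorname{Hom}_{\mathsf G}(X\oplus A,B)$. Let $\mathsf G^{\mathbf U}$ be the groupoid of finite-dimensional complex inner product spaces and linear isometric isomorphisms, with orthogonal direct sum, and let $\mathsf G^{\mathbf S}$ be the groupoid of finite-dimensional real symplectic vector spaces and symplectic isomorphisms, with direct sum; in both, the morphism spaces are topologized as subspaces of the finite-dimensional spaces of linear maps. Put $\mathcal J^{\mathbf U}=\langle\mathsf G^{\mathbf U},\mathsf G^{\mathbf U}\rangle$ and $\mathcal J^{\mathbf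 S}=\langle\mathsf G^{\mathbf S},\mathsf G^{\mathbf S}\rangle$. Let $\Im\colon\mathcal J^{\mathbf U}\to\mathcal J^{\mathbf S}$ be the functor which sends a complex inner product space $V$ to its underlying real vector space with the symplectic form $\omega(x,y)=\operatorname{Im}\langle x,y\rangle$, and a morphism $[X,f]$ to $[\Im X,\Im f]$, where $\Im f$ is $f$ regarded as a real linear map (under the canonical identification $\Im X\oplus\Im A\cong\Im(X\oplus A)$). Then $\Im\colon\mathcal J^{\mathbf U}\to\mathcal J^{\mathbf S}$ is a Dwyer–Kan equivalence of topologically enriched categories, that is: 1. for all $V,W\in\mathcal J^{\mathbf U}$ the map $\mathcal J^{\mathbf U}(V,W)\to\mathcal J^{\mathbf S}(\Im V,\Im W)$ is a weak homotopy equivalence; 2. the induced functor $\pi_0\mathcal J^{\mathbf U}\to\pi_0\mathcal J^{\mathbf S}$ on homotopy categories (same objects, morphisms the path components of the morphism spaces) is essentially surjective. -/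

import Mathlib

open CategoryTheory MonoidalCategory

universe v v₁ v₂ u u₁ u₂

noncomputable section

/-! ### Weak homotopy equivalences -/

namespace WeakHomotopy

variable {X : Type u₁} {Y : Type u₂} [TopologicalSpace X] [TopologicalSpace Y]

/-- The map on sets of path components induced by a continuous map. -/
def mapZeroth (f : C(X, Y)) : ZerothHomotopy X → ZerothHomotopy Y :=
  Quotient.map f fun _ _ h => h.map f.continuous

/-- Postcomposition of a generalized loop with a continuous map. -/
def mapGenLoop (f : C(X, Y)) (N : Type) (x : X) (p : GenLoop N X x) : GenLoop N Y (f x) :=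
  ⟨f.comp p.1, fun y hy => congrArg f (p.2 y hy)⟩

/-- The map on `n`-th homotopy groups induced by a continuous map. -/
def mapPi (f : C(X, Y)) (n : ℕ) (x : X) :
    HomotopyGroup.Pi n X x → HomotopyGroup.Pi n Y (f x) :=
  Quotient.map (mapGenLoop f (Fin n) x) fun _ _ h => h.map fun H => H.compContinuousMap f

end WeakHomotopy

/-- A weak homotopy equivalence: a continuous map inducing a bijection on path components
and on all homotopy groups at all base points. -/
structure IsWeakHomotopyEquiv {X : Type u₁} {Y : Type u₂} [TopologicalSpace X]
    [TopologicalSpace Y] (f : C(X, Y)) : Prop where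
  bijective_zeroth : Function.Bijective (WeakHomotopy.mapZeroth f)
  bijective_pi : ∀ (n : ℕ) (x : X), 1 ≤ n → Function.Bijective (WeakHomotopy.mapPi f n x)

/-! ### Topologically enriched categories and Dwyer–Kan equivalences -/

/-- A topological enrichment of a category: a topology on every set of morphisms for which
composition is jointly continuous. -/
class TopEnriched (C : Type u) [Category.{v} C] where
  top : ∀ X Y : C, TopologicalSpace (X ⟶ Y)
  continuous_comp : ∀ X Y Z : C, Continuous fun p : (X ⟶ Y) × (Y ⟶ Z) => p.1 ≫ p.2

attribute [reducible, instance] TopEnriched.top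

/-- A topologically enriched functor: one which is continuous on spaces of morphisms. -/
class IsTopFunctor {C : Type u₁} [Category.{v₁} C] [TopEnriched C] {D : Type u₂}
    [Category.{v₂} D] [TopEnriched D] (F : C ⥤ D) : Prop where
  continuous_map : ∀ X Y : C, Continuous fun f : X ⟶ Y => F.map f

section DwyerKan

/-- Two morphisms are related when a path in the morphism space joins them. -/
def pathRel (C : Type u) [Category.{v} C] [TopEnriched C] : HomRel C :=
  fun _ _ f g => Joined f g

instance (C : Type u) [Category.{v} C] [TopEnriched C] : Congruence (pathRel C) where
  equivalence := ⟨Joined.refl, Joined.symm, Joined.trans⟩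
  comp_left {X Y Z} f _ _ h := Joined.map h
    ((TopEnriched.continuous_comp X Y Z).comp (Continuous.prodMk_right f))
  comp_right {X Y Z} _ _ g h := Joined.map h
    ((TopEnriched.continuous_comp X Y Z).comp (Continuous.prodMk_left g))

/-- The homotopy category `π₀ C`: the objects of `C`, with morphisms the path components
of the morphism spaces of `C`. -/
abbrev PiZeroCat (C : Type u) [Category.{v} C] [TopEnriched C] :=
  CategoryTheory.Quotient (pathRel C)

variable {C : Type u₁} [Category.{v₁} C] [TopEnriched C]
  {D : Type u₂} [Category.{v₂} D] [TopEnriched D]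

/-- The functor `π₀ F : π₀ C ⥤ π₀ D` induced by a topologically enriched functor. -/
def piZeroFunctor (F : C ⥤ D) [IsTopFunctor F] : PiZeroCat C ⥤ PiZeroCat D :=
  CategoryTheory.Quotient.lift _ (F ⋙ CategoryTheory.Quotient.functor (pathRel D))
    fun X Y _ _ h => CategoryTheory.Quotient.sound (pathRel D)
      (Joined.map h (IsTopFunctor.continuous_map (F := F) X Y))

/-- The continuous map between morphism spaces given by a topologically enriched functor. -/
def homMap (F : C ⥤ D) [IsTopFunctor F] (X Y : C) : C(X ⟶ Y, F.obj X ⟶ F.obj Y) :=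
  ⟨fun f => F.map f, IsTopFunctor.continuous_map X Y⟩

/-- A Dwyer–Kan equivalence of topologically enriched categories: a topologically enriched
functor which is a weak homotopy equivalence on all morphism spaces and which is essentially
surjective on homotopy categories. -/
structure IsDwyerKanEquivalence (F : C ⥤ D) [IsTopFunctor F] : Prop where
  fullyFaithful : ∀ X Y : C, IsWeakHomotopyEquiv (homMap F X Y)
  essSurj : (piZeroFunctor F).EssSurj

end DwyerKan

/-! ### Quillen's bracket construction -/

/-- The compatibility of a topological enrichment with a monoidal structure:
the tensor product is continuous on morphism spaces. -/
class IsTopMonoidal (G : Type u) [Category.{v} G] [MonoidalCategory G] [TopEnriched G] :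
    Prop where
  continuous_tensor : ∀ A B C D : G,
    Continuous fun p : (A ⟶ B) × (C ⟶ D) => p.1 ⊗ₘ p.2

/-- The objects of Quillen's bracket construction `⟨G, G⟩` are the objects of `G`. -/
structure QuillenBracket (G : Type u) where
  ob : G

namespace QuillenBracket

section Basic

variable {G : Type u} [Groupoid.{v} G] [MonoidalCategory G]

/-- Pairs `(X, f)` of an object `X` and a morphism `f : X ⊗ A ⟶ B`. -/
abbrev Pre (A B : G) := Σ X : G, (X ⊗ A ⟶ B)

/-- `(X, f) ∼ (X', f')` when some `g : X ⟶ X'` in the groupoid satisfies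
`f' ∘ (g ⊗ A) = f`. -/
instance preSetoid (A B : G) : Setoid (Pre A B) where
  r p q := ∃ g : p.1 ⟶ q.1, g ▷ A ≫ q.2 = p.2
  iseqv :=
    { refl := fun p => ⟨𝟙 _, by simp⟩
      symm := by
        rintro p q ⟨g, h⟩
        exact ⟨inv g, by rw [← h]; simp⟩
      trans := by
        rintro p q r ⟨g, h⟩ ⟨g', h'⟩
        exact ⟨g ≫ g', by rw [← h, ← h']; simp⟩ }

/-- Morphisms `A ⟶ B` of the bracket construction: classes `[X, f]`. -/
def Hom (A B : QuillenBracket G) := _root_.Quotient (preSetoid A.ob B.ob)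

/-- The class `[X, f]`. -/
def cls {A B : QuillenBracket G} (X : G) (f : X ⊗ A.ob ⟶ B.ob) : Hom A B :=
  _root_.Quotient.mk (preSetoid A.ob B.ob) ⟨X, f⟩

theorem cls_eq {A B : QuillenBracket G} {X X' : G} {f : X ⊗ A.ob ⟶ B.ob} {f' : X' ⊗ A.ob ⟶ B.ob}
    (g : X ⟶ X') (h : g ▷ A.ob ≫ f' = f) : cls X f = cls (A := A) X' f' :=
  _root_.Quotient.sound ⟨g, h⟩

/-- The composite of representatives: `(X, f)` followed by `(Y, g)` is
`(Y ⊗ X, g ∘ (Y ⊗ f))`, with the associator inserted. -/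
def preComp {A B C : G} (p : Pre A B) (q : Pre B C) : Pre A C :=
  ⟨q.1 ⊗ p.1, (α_ q.1 p.1 A).hom ≫ q.1 ◁ p.2 ≫ q.2⟩

theorem preComp_congr {A B C : G} {p p' : Pre A B} {q q' : Pre B C} (hp : p ≈ p')
    (hq : q ≈ q') : preComp p q ≈ preComp p' q' := by
  obtain ⟨g, h⟩ := hp
  obtain ⟨g', h'⟩ := hq
  refine ⟨g' ⊗ₘ g, ?_⟩
  simp only [preComp, ← h, ← h']
  simp [MonoidalCategory.tensorHom_def', whisker_exchange_assoc]

/-- Composition `[Y, g] ∘ [X, f] = [Y ⊗ X, g ∘ (Y ⊗ f)]`. -/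
def comp {A B C : QuillenBracket G} (p : Hom A B) (q : Hom B C) : Hom A C :=
  Quotient.map₂ preComp (fun _ _ hp _ _ hq => preComp_congr hp hq) p q

instance category : Category (QuillenBracket G) where
  Hom := Hom
  id A := cls (𝟙_ G) (λ_ A.ob).hom
  comp := comp
  id_comp := by
    rintro A B ⟨X, f⟩
    exact cls_eq (ρ_ X).hom (by simp)
  comp_id := by
    rintro A B ⟨X, f⟩
    exact cls_eq (λ_ X).hom (by simp)
  assoc := by
    rintro A B C D ⟨X, f⟩ ⟨Y, g⟩ ⟨Z, h⟩
    exact cls_eq (α_ Z Y X).inv (by simp [preComp])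

end Basic

section Topology

variable {G : Type u} [Groupoid.{v} G] [MonoidalCategory G] [TopEnriched G]

/-- The topology on the morphisms of the bracket construction is that of the colimit of the
spaces `X ⊗ A ⟶ B` over the objects `X` of the groupoid, that is, the quotient topology on
the quotient of their disjoint union. -/
instance homTop (A B : QuillenBracket G) : TopologicalSpace (A ⟶ B) :=
  inferInstanceAs (TopologicalSpace (_root_.Quotient (preSetoid A.ob B.ob)))

/-- The projection from the disjoint union of the spaces `X ⊗ A ⟶ B`. -/
def proj (A B : QuillenBracket G) (p : Pre A.ob B.ob) : A ⟶ B :=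
  _root_.Quotient.mk (preSetoid A.ob B.ob) p

theorem isOpenQuotientMap_proj (A B : QuillenBracket G) : IsOpenQuotientMap (proj A B) where
  surjective := Quotient.mk_surjective
  continuous := continuous_quotient_mk'
  isOpenMap := by
    intro U hU
    rw [show IsOpen (proj A B '' U) ↔ IsOpen (proj A B ⁻¹' (proj A B '' U)) from Iff.rfl]
    rw [isOpen_sigma_iff] at hU ⊢
    intro X
    have : Sigma.mk X ⁻¹' (proj A B ⁻¹' (proj A B '' U)) =
        ⋃ (X' : G) (g : X' ⟶ X),
          (fun f : X ⊗ A.ob ⟶ B.ob => g ▷ A.ob ≫ f) ⁻¹' ((fun f' => (⟨X', f'⟩ : Pre A.ob B.ob)) ⁻¹' U) := by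
      ext f
      simp only [Set.mem_preimage, Set.mem_image, Set.mem_iUnion]
      constructor
      · rintro ⟨⟨X', f'⟩, hU', h⟩
        obtain ⟨g, hg⟩ := _root_.Quotient.exact h
        refine ⟨X', g, ?_⟩
        dsimp only at hg
        rwa [hg]
      · rintro ⟨X', g, h⟩
        exact ⟨_, h, cls_eq g rfl⟩
    rw [this]
    refine isOpen_iUnion fun X' => isOpen_iUnion fun g => (hU X').preimage ?_
    exact (TopEnriched.continuous_comp _ _ _).comp (Continuous.prodMk_right (g ▷ A.ob))

theorem continuous_preComp [IsTopMonoidal G] (A B C : G) :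
    Continuous fun p : Pre A B × Pre B C => preComp p.1 p.2 := by
  rw [continuous_iff_continuousAt]
  rintro ⟨⟨X, f⟩, ⟨Y, g⟩⟩
  have hX : Topology.IsOpenEmbedding (Sigma.mk (β := fun X : G => (X ⊗ A ⟶ B)) X) :=
    Topology.IsOpenEmbedding.sigmaMk
  have hY : Topology.IsOpenEmbedding (Sigma.mk (β := fun Y : G => (Y ⊗ B ⟶ C)) Y) :=
    Topology.IsOpenEmbedding.sigmaMk
  have he := hX.prodMap hY
  refine (he.continuousAt_iff (x := (f, g))).1 (Continuous.continuousAt ?_)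
  have hm : Continuous (Sigma.mk (β := fun X : G => (X ⊗ A ⟶ C)) (Y ⊗ X)) := continuous_sigmaMk
  refine hm.comp
    (f := fun p : (X ⊗ A ⟶ B) × (Y ⊗ B ⟶ C) => (α_ Y X A).hom ≫ Y ◁ p.1 ≫ p.2) ?_
  have h₁ : Continuous fun f : X ⊗ A ⟶ B => Y ◁ f := by
    simp only [← id_tensorHom]
    exact (IsTopMonoidal.continuous_tensor _ _ _ _).comp (Continuous.prodMk_right (𝟙 Y))
  exact (TopEnriched.continuous_comp _ _ _).comp (continuous_const.prodMk
    ((TopEnriched.continuous_comp _ _ _).comp ((h₁.comp continuous_fst).prodMk continuous_snd)))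

instance topEnriched [IsTopMonoidal G] : TopEnriched (QuillenBracket G) where
  top := homTop
  continuous_comp A B C := by
    refine ((isOpenQuotientMap_proj A B).prodMap
      (isOpenQuotientMap_proj B C)).isQuotientMap.continuous_iff.2 ?_
    exact (isOpenQuotientMap_proj A C).continuous.comp (continuous_preComp A.ob B.ob C.ob)

end Topology

section Functoriality

variable {G : Type u₁} [Groupoid.{v₁} G] [MonoidalCategory G]
  {H : Type u₂} [Groupoid.{v₂} H] [MonoidalCategory H]

open Functor.LaxMonoidal Functor.OplaxMonoidal

/-- The action of a strong monoidal functor on representatives: `(X, f)` goes to `(F X, F f)`,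
with the tensorator `F X ⊗ F A ≅ F (X ⊗ A)` inserted. -/
def preMap (F : G ⥤ H) [F.Monoidal] {A B : G} (p : Pre A B) : Pre (F.obj A) (F.obj B) :=
  ⟨F.obj p.1, μ F p.1 A ≫ F.map p.2⟩

theorem preMap_congr (F : G ⥤ H) [F.Monoidal] {A B : G} {p q : Pre A B} (h : p ≈ q) :
    preMap F p ≈ preMap F q := by
  obtain ⟨g, h⟩ := h
  refine ⟨F.map g, ?_⟩
  simp [preMap, ← h]

/-- The functor `⟨F⟩ : ⟨G, G⟩ ⥤ ⟨H, H⟩` induced by a strong monoidal functor `F : G ⥤ H`. -/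
def map (F : G ⥤ H) [F.Monoidal] : QuillenBracket G ⥤ QuillenBracket H where
  obj A := ⟨F.obj A.ob⟩
  map {A B} p := Quotient.map (preMap F) (fun _ _ h => preMap_congr F h) p
  map_id A := Eq.symm (cls_eq (ε F) (by simp))
  map_comp := by
    rintro A B C ⟨X, f⟩ ⟨Y, g⟩
    exact Eq.symm (cls_eq (μ F Y X) (by simp [preMap, preComp]))

instance isTopFunctor_map [TopEnriched G] [IsTopMonoidal G] [TopEnriched H] [IsTopMonoidal H]
    (F : G ⥤ H) [F.Monoidal] [IsTopFunctor F] : IsTopFunctor (map F) where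
  continuous_map A B := by
    refine (isOpenQuotientMap_proj A B).isQuotientMap.continuous_iff.2 ?_
    refine (isOpenQuotientMap_proj ((map F).obj A) ((map F).obj B)).continuous.comp
      (f := preMap F) ?_
    refine continuous_sigma fun X => (continuous_sigmaMk
      (σ := fun Y : H => (Y ⊗ F.obj A.ob ⟶ F.obj B.ob)) (i := F.obj X)).comp
        (f := fun f => μ F X A.ob ≫ F.map f) ?_
    exact (TopEnriched.continuous_comp _ _ _).comp (continuous_const.prodMk
      (IsTopFunctor.continuous_map _ _))

end Functoriality

end QuillenBracket

/-! ### The unitary groupoid -/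

/-- A finite-dimensional complex inner product space. -/
structure HermitianSpace : Type (u + 1) where
  carrier : Type u
  [normedAddCommGroup : NormedAddCommGroup carrier]
  [innerProductSpace : InnerProductSpace ℂ carrier]
  [finiteDimensional : FiniteDimensional ℂ carrier]

namespace HermitianSpace

instance : CoeSort HermitianSpace.{u} (Type u) := ⟨carrier⟩

attribute [instance] normedAddCommGroup innerProductSpace finiteDimensional

/-- The groupoid of finite-dimensional complex inner product spaces and linear isometric
isomorphisms. -/
instance groupoid : Groupoid HermitianSpace.{u} where
  Hom V W := V ≃ₗᵢ[ℂ] W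
  id V := LinearIsometryEquiv.refl ℂ V
  comp f g := f.trans g
  inv f := f.symm
  inv_comp f := f.symm_trans_self
  comp_inv f := f.self_trans_symm

/-- A linear isometric isomorphism as a morphism of the groupoid. -/
def ofIso {V W : HermitianSpace.{u}} (f : V ≃ₗᵢ[ℂ] W) : V ⟶ W := f

/-- The linear isometric isomorphism underlying a morphism of the groupoid. -/
def toIso {V W : HermitianSpace.{u}} (f : V ⟶ W) : V ≃ₗᵢ[ℂ] W := f

theorem hom_ext {V W : HermitianSpace.{u}} {f g : V ⟶ W} (h : ∀ x, toIso f x = toIso g x) :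
    f = g := LinearIsometryEquiv.ext h

/-- The underlying continuous linear map of a morphism. -/
def toCLM {V W : HermitianSpace.{u}} (f : V ⟶ W) : V →L[ℂ] W :=
  (toIso f : V ≃L[ℂ] W)

/-- The morphism spaces carry the topology of the operator norm. -/
instance topEnriched : TopEnriched HermitianSpace.{u} where
  top V W := TopologicalSpace.induced toCLM inferInstance
  continuous_comp U V W := by
    let _ : ∀ V W : HermitianSpace.{u}, TopologicalSpace (V ⟶ W) := fun V W =>
      TopologicalSpace.induced toCLM inferInstance
    have h : ∀ V W : HermitianSpace.{u}, Continuous (toCLM : (V ⟶ W) → _) :=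
      fun _ _ => continuous_induced_dom
    rw [continuous_induced_rng]
    exact ((h V W).comp continuous_snd).clm_comp ((h U V).comp continuous_fst)

theorem continuous_toCLM (V W : HermitianSpace.{u}) : Continuous (toCLM : (V ⟶ W) → _) :=
  continuous_induced_dom

/-- The isomorphism of the groupoid given by a linear isometric isomorphism. -/
def mkIso {V W : HermitianSpace.{u}} (f : V ≃ₗᵢ[ℂ] W) : V ≅ W where
  hom := f
  inv := f.symm
  hom_inv_id := f.self_trans_symm
  inv_hom_id := f.symm_trans_self

/-- The monoidal structure given by the orthogonal direct sum. -/
instance monoidalStruct : MonoidalCategoryStruct HermitianSpace.{u} where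
  tensorObj V W := ⟨WithLp 2 (V × W)⟩
  whiskerLeft V _ _ f := LinearIsometryEquiv.withLpProdCongr 2 (.refl ℂ V) f
  whiskerRight f W := LinearIsometryEquiv.withLpProdCongr 2 f (.refl ℂ W)
  tensorHom f g := LinearIsometryEquiv.withLpProdCongr 2 f g
  tensorUnit := ⟨EuclideanSpace ℂ PEmpty.{u + 1}⟩
  associator U V W := mkIso (LinearIsometryEquiv.withLpProdAssoc 2 ℂ U V W)
  leftUnitor V := mkIso (LinearIsometryEquiv.withLpUniqueProd 2 ℂ _ V)
  rightUnitor V := mkIso (LinearIsometryEquiv.withLpProdUnique 2 ℂ V _)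

instance monoidal : MonoidalCategory HermitianSpace.{u} :=
  MonoidalCategory.ofTensorHom
    (id_tensorHom_id := fun _ _ => hom_ext fun _ => rfl)
    (id_tensorHom := fun _ _ _ _ => hom_ext fun _ => rfl)
    (tensorHom_id := fun _ _ => hom_ext fun _ => rfl)
    (tensorHom_comp_tensorHom := fun _ _ _ _ => hom_ext fun _ => rfl)
    (associator_naturality := fun _ _ _ => hom_ext fun _ => rfl)
    (leftUnitor_naturality := fun _ => hom_ext fun _ => rfl)
    (rightUnitor_naturality := fun _ => hom_ext fun _ => rfl)
    (pentagon := fun _ _ _ _ => hom_ext fun _ => rfl)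
    (triangle := fun _ _ => hom_ext fun _ => rfl)

instance isTopMonoidal : IsTopMonoidal HermitianSpace.{u} where
  continuous_tensor A B C D := by
    rw [continuous_induced_rng]
    have h : Continuous fun p : (A ⟶ B) × (C ⟶ D) =>
        ContinuousLinearMap.prodMapL ℂ A B C D (toCLM p.1, toCLM p.2) :=
      (ContinuousLinearMap.prodMapL ℂ A B C D).continuous.comp
        ((continuous_toCLM A B).prodMap (continuous_toCLM C D))
    exact (continuous_const (y := ((WithLp.prodContinuousLinearEquiv 2 ℂ B D).symm :
      (B × D) →L[ℂ] WithLp 2 (B × D)))).clm_comp (h.clm_comp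
        (continuous_const (y := ((WithLp.prodContinuousLinearEquiv 2 ℂ A C) :
          WithLp 2 (A × C) →L[ℂ] (A × C)))))

end HermitianSpace

/-! ### The symplectic groupoid -/

/-- A finite-dimensional real symplectic vector space. -/
structure SymplecticSpace : Type (u + 1) where
  carrier : Type u
  [addCommGroup : AddCommGroup carrier]
  [module : Module ℝ carrier]
  [finiteDimensional : FiniteDimensional ℝ carrier]
  form : carrier →ₗ[ℝ] carrier →ₗ[ℝ] ℝ
  isAlt : form.IsAlt
  nondegenerate : form.Nondegenerate

namespace SymplecticSpace

instance : CoeSort SymplecticSpace.{u} (Type u) := ⟨carrier⟩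

attribute [instance] addCommGroup module finiteDimensional

/-- A symplectic isomorphism: a linear isomorphism preserving the symplectic forms. -/
structure Iso (V W : SymplecticSpace.{u}) where
  toEquiv : V ≃ₗ[ℝ] W
  map_form : ∀ x y, W.form (toEquiv x) (toEquiv y) = V.form x y

theorem Iso.ext {V W : SymplecticSpace.{u}} {f g : Iso V W}
    (h : ∀ x, f.toEquiv x = g.toEquiv x) : f = g := by
  obtain ⟨f, hf⟩ := f
  obtain ⟨g, hg⟩ := g
  obtain rfl : f = g := LinearEquiv.ext h
  rfl

/-- The inverse of a symplectic isomorphism. -/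
def Iso.symm {V W : SymplecticSpace.{u}} (f : Iso V W) : Iso W V :=
  ⟨f.toEquiv.symm, fun x y => by rw [← f.map_form]; simp⟩

/-- The groupoid of finite-dimensional real symplectic vector spaces and symplectic
isomorphisms. -/
instance groupoid : Groupoid SymplecticSpace.{u} where
  Hom V W := Iso V W
  id V := ⟨LinearEquiv.refl ℝ V, fun _ _ => rfl⟩
  comp f g := ⟨f.toEquiv.trans g.toEquiv, fun x y => by simp [g.map_form, f.map_form]⟩
  inv f := f.symm
  inv_comp f := Iso.ext fun x => f.toEquiv.apply_symm_apply x
  comp_inv f := Iso.ext fun x => f.toEquiv.symm_apply_apply x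

/-- The linear isomorphism underlying a morphism of the groupoid. -/
def toEquiv {V W : SymplecticSpace.{u}} (f : V ⟶ W) : V ≃ₗ[ℝ] W := Iso.toEquiv f

/-- The linear map underlying a morphism of the groupoid. -/
def toLin {V W : SymplecticSpace.{u}} (f : V ⟶ W) : V →ₗ[ℝ] W := (toEquiv f).toLinearMap

theorem hom_ext {V W : SymplecticSpace.{u}} {f g : V ⟶ W} (h : ∀ x, toEquiv f x = toEquiv g x) :
    f = g := Iso.ext h

/-- The morphism spaces are topologized as subspaces of the finite-dimensional real vector
spaces of linear maps with their canonical topology. -/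
instance topEnriched : TopEnriched SymplecticSpace.{u} where
  top V W := TopologicalSpace.induced toLin (moduleTopology ℝ (V →ₗ[ℝ] W))
  continuous_comp U V W := by
    let _ : ∀ V W : SymplecticSpace.{u}, TopologicalSpace (V →ₗ[ℝ] W) := fun V W =>
      moduleTopology ℝ (V →ₗ[ℝ] W)
    have _ : ∀ V W : SymplecticSpace.{u}, IsModuleTopology ℝ (V →ₗ[ℝ] W) := fun _ _ => ⟨rfl⟩
    let _ : ∀ V W : SymplecticSpace.{u}, TopologicalSpace (V ⟶ W) := fun V W =>
      TopologicalSpace.induced toLin inferInstance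
    have h : ∀ V W : SymplecticSpace.{u}, Continuous (toLin : (V ⟶ W) → _) :=
      fun _ _ => continuous_induced_dom
    rw [continuous_induced_rng]
    exact (IsModuleTopology.continuous_bilinear_of_finite_left (R := ℝ)
      (LinearMap.llcomp ℝ U V W)).comp
        (((h V W).comp continuous_snd).prodMk ((h U V).comp continuous_fst))

/-- The isomorphism of the groupoid given by a linear isomorphism preserving the forms. -/
def mkIso {V W : SymplecticSpace.{u}} (f : V ≃ₗ[ℝ] W)
    (hf : ∀ x y, W.form (f x) (f y) = V.form x y) : V ≅ W where
  hom := Iso.mk f hf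
  inv := (Iso.mk f hf).symm
  hom_inv_id := Iso.ext fun x => f.symm_apply_apply x
  inv_hom_id := Iso.ext fun x => f.apply_symm_apply x

/-- The direct sum of symplectic vector spaces, with
`ω ((v, w), (v', w')) = ω (v, v') + ω (w, w')`. -/
def prod (V W : SymplecticSpace.{u}) : SymplecticSpace.{u} where
  carrier := V × W
  form := V.form.compl₁₂ (LinearMap.fst ℝ V W) (LinearMap.fst ℝ V W) +
    W.form.compl₁₂ (LinearMap.snd ℝ V W) (LinearMap.snd ℝ V W)
  isAlt := fun x => by simp [V.isAlt x.1, W.isAlt x.2]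
  nondegenerate := by
    constructor
    · rintro ⟨v, w⟩ h
      refine Prod.ext (V.nondegenerate.1 v fun y => ?_) (W.nondegenerate.1 w fun y => ?_)
      · simpa using h (y, 0)
      · simpa using h (0, y)
    · rintro ⟨v, w⟩ h
      refine Prod.ext (V.nondegenerate.2 v fun y => ?_) (W.nondegenerate.2 w fun y => ?_)
      · simpa using h (y, 0)
      · simpa using h (0, y)

theorem prod_form (V W : SymplecticSpace.{u}) (x y : V × W) :
    (prod V W).form x y = V.form x.1 y.1 + W.form x.2 y.2 := rfl

/-- The zero symplectic vector space. -/
def zero : SymplecticSpace.{u} where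
  carrier := PUnit.{u + 1}
  form := 0
  isAlt := fun _ => rfl
  nondegenerate := ⟨fun _ _ => rfl, fun _ _ => rfl⟩

/-- The direct sum of symplectic isomorphisms. -/
def prodMap {V V' W W' : SymplecticSpace.{u}} (f : Iso V V') (g : Iso W W') :
    Iso (prod V W) (prod V' W') :=
  ⟨LinearEquiv.prodCongr f.toEquiv g.toEquiv, fun x y =>
    congrArg₂ (· + ·) (f.map_form x.1 y.1) (g.map_form x.2 y.2)⟩

/-- The monoidal structure given by the direct sum. -/
instance monoidalStruct : MonoidalCategoryStruct SymplecticSpace.{u} where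
  tensorObj := prod
  whiskerLeft V _ _ f := prodMap (groupoid.id V) f
  whiskerRight f W := prodMap f (groupoid.id W)
  tensorHom f g := prodMap f g
  tensorUnit := zero
  associator U V W := mkIso (V := prod (prod U V) W) (W := prod U (prod V W))
    (LinearEquiv.prodAssoc ℝ U V W) fun _ _ => (add_assoc _ _ _).symm
  leftUnitor V := mkIso (V := prod zero V) (LinearEquiv.uniqueProd (M₂ := PUnit.{u + 1}))
    fun _ _ => (zero_add _).symm
  rightUnitor V := mkIso (V := prod V zero) (LinearEquiv.prodUnique (M₂ := PUnit.{u + 1}))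
    fun _ _ => (add_zero _).symm

instance monoidal : MonoidalCategory SymplecticSpace.{u} :=
  MonoidalCategory.ofTensorHom
    (id_tensorHom_id := fun _ _ => hom_ext fun _ => rfl)
    (id_tensorHom := fun _ _ _ _ => hom_ext fun _ => rfl)
    (tensorHom_id := fun _ _ => hom_ext fun _ => rfl)
    (tensorHom_comp_tensorHom := fun _ _ _ _ => hom_ext fun _ => rfl)
    (associator_naturality := fun _ _ _ => hom_ext fun _ => rfl)
    (leftUnitor_naturality := fun _ => hom_ext fun _ => rfl)
    (rightUnitor_naturality := fun _ => hom_ext fun _ => rfl)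
    (pentagon := fun _ _ _ _ => hom_ext fun _ => rfl)
    (triangle := fun _ _ => hom_ext fun _ => rfl)

instance isTopMonoidal : IsTopMonoidal SymplecticSpace.{u} where
  continuous_tensor A B C D := by
    let _ : ∀ V W : SymplecticSpace.{u}, TopologicalSpace (V →ₗ[ℝ] W) := fun V W =>
      moduleTopology ℝ (V →ₗ[ℝ] W)
    have _ : ∀ V W : SymplecticSpace.{u}, IsModuleTopology ℝ (V →ₗ[ℝ] W) := fun _ _ => ⟨rfl⟩
    have h : ∀ V W : SymplecticSpace.{u}, Continuous (toLin : (V ⟶ W) → _) :=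
      fun _ _ => continuous_induced_dom
    rw [continuous_induced_rng]
    let _ : TopologicalSpace (A × C →ₗ[ℝ] B × D) := moduleTopology ℝ _
    have _ : IsModuleTopology ℝ (A × C →ₗ[ℝ] B × D) := ⟨rfl⟩
    have _ : ContinuousAdd (A × C →ₗ[ℝ] B × D) := IsModuleTopology.toContinuousAdd ℝ _
    have _ : ContinuousSMul ℝ (A × C →ₗ[ℝ] B × D) := IsModuleTopology.toContinuousSMul ℝ _
    exact (IsModuleTopology.continuous_of_linearMap
      (LinearMap.prodMapLinear ℝ A C B D ℝ)).comp ((h A B).prodMap (h C D))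

end SymplecticSpace

/-! ### The functor `Im` -/

namespace HermitianSpace

/-- The underlying real vector space of a Hermitian space, with the symplectic form
`ω (x, y) = Im ⟨x, y⟩`. -/
def imObj (V : HermitianSpace.{u}) : SymplecticSpace.{u} where
  carrier := V
  finiteDimensional := FiniteDimensional.complexToReal V
  form := LinearMap.mk₂ ℝ (fun x y : V => (inner ℂ x y).im)
    (fun x y z => by simp)
    (fun c x y => by simp [inner_smul_left_eq_smul])
    (fun x y z => by simp)
    (fun c x y => by simp [inner_smul_right_eq_smul])
  isAlt := fun x => inner_self_im (𝕜 := ℂ) x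
  nondegenerate := by
    have key : ∀ x : V, (∀ y, (inner ℂ x y).im = 0) → x = 0 := by
      intro x h
      have h' := h (Complex.I • x)
      rw [inner_smul_right, inner_self_eq_norm_sq_to_K] at h'
      simpa [← Complex.ofReal_pow] using h'
    refine ⟨key, fun x h => key x fun y => ?_⟩
    rw [← inner_conj_symm, Complex.conj_im]
    simpa using h y

theorem imObj_form (V : HermitianSpace.{u}) (x y : V) :
    (imObj V).form x y = (inner ℂ x y).im := rfl

/-- The functor `Im` from the unitary groupoid to the symplectic groupoid, which sends a linear
isometric isomorphism to its underlying real linear map. -/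
def imFunctor : HermitianSpace.{u} ⥤ SymplecticSpace.{u} where
  obj := imObj
  map {V W} f := SymplecticSpace.Iso.mk (V := imObj V) (W := imObj W)
    ((toIso f).toLinearEquiv.restrictScalars ℝ)
    fun x y => congrArg Complex.im ((toIso f).inner_map_map x y)
  map_id _ := SymplecticSpace.hom_ext fun _ => rfl
  map_comp _ _ := SymplecticSpace.hom_ext fun _ => rfl

instance isTopFunctor_imFunctor : IsTopFunctor imFunctor.{u} where
  continuous_map V W := by
    rw [continuous_induced_rng]
    let _ : TopologicalSpace (imObj V →ₗ[ℝ] imObj W) := moduleTopology ℝ _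
    have _ : IsModuleTopology ℝ (imObj V →ₗ[ℝ] imObj W) := ⟨rfl⟩
    have _ : IsTopologicalAddGroup (imObj V →ₗ[ℝ] imObj W) :=
      IsModuleTopology.topologicalAddGroup ℝ _
    have _ : ContinuousSMul ℝ (imObj V →ₗ[ℝ] imObj W) := IsModuleTopology.toContinuousSMul ℝ _
    let L : (V →L[ℂ] W) →ₗ[ℝ] (imObj V →ₗ[ℝ] imObj W) :=
      { toFun := fun f => (f : V →ₗ[ℂ] W).restrictScalars ℝ
        map_add' := fun _ _ => rfl
        map_smul' := fun _ _ => rfl }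
    have _ : FiniteDimensional ℝ (V →L[ℂ] W) := FiniteDimensional.complexToReal _
    exact L.continuous_of_finiteDimensional.comp (continuous_toCLM V W)

/-- `Im` carries orthogonal direct sums to direct sums of symplectic vector spaces. -/
instance monoidal_imFunctor : imFunctor.{u}.Monoidal :=
  Functor.CoreMonoidal.toMonoidal
    { εIso := SymplecticSpace.mkIso (V := SymplecticSpace.zero)
        (W := imObj ⟨EuclideanSpace ℂ PEmpty.{u + 1}⟩)
        { toFun := fun _ => 0
          map_add' := fun _ _ => (add_zero _).symm
          map_smul' := fun _ _ => (smul_zero _).symm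
          invFun := fun _ => PUnit.unit
          left_inv := fun _ => rfl
          right_inv := fun _ => Subsingleton.elim (α := EuclideanSpace ℂ PEmpty.{u + 1}) _ _ }
        fun _ _ => congrArg Complex.im
          (inner_zero_left (𝕜 := ℂ) (0 : EuclideanSpace ℂ PEmpty.{u + 1}))
      μIso := fun V W => SymplecticSpace.mkIso (V := SymplecticSpace.prod (imObj V) (imObj W))
        (W := imObj ⟨WithLp 2 (V × W)⟩) (WithLp.linearEquiv 2 ℝ (V × W)).symm
        fun _ _ => congrArg Complex.im (WithLp.prod_inner_apply _ _)
      μIso_hom_natural_left := fun _ _ => SymplecticSpace.hom_ext fun _ => rfl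
      μIso_hom_natural_right := fun _ _ => SymplecticSpace.hom_ext fun _ => rfl
      associativity := fun _ _ _ => SymplecticSpace.hom_ext fun _ => rfl
      left_unitality := fun _ => SymplecticSpace.hom_ext fun _ => rfl
      right_unitality := fun _ => SymplecticSpace.hom_ext fun _ => rfl }

end HermitianSpace

/-! ### The diagram categories -/

/-- The category `J^U`: Quillen's bracket construction on the unitary groupoid. -/
abbrev UnitaryJ : Type (u + 1) := QuillenBracket HermitianSpace.{u}

/-- The category `J^S`: Quillen's bracket construction on the symplectic groupoid. -/
abbrev SymplecticJ : Type (u + 1) := QuillenBracket SymplecticSpace.{u}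

/-- The functor `Im : J^U ⥤ J^S`, which sends `V` to its underlying real vector space with the
imaginary part of the inner product, and `[X, f]` to `[Im X, Im f]`. -/
abbrev imJ : UnitaryJ.{u} ⥤ SymplecticJ.{u} := QuillenBracket.map HermitianSpace.imFunctor.{u}

end

/-! A class [X, f] from A to B is determined by the restriction of f to A, because X must map onto
the complement of the image of A. Hence J^S(Im V, Im W) is the space of real linear maps T : V → W
preserving ω (`homHomeomorph`), and J^U(V, W) is the closed subspace of the complex linear ones;
these are isometric because |x|² = ω(x, ix).

The large space is deformed onto the small one as follows. Write T = a + b with a complex linear and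
b antilinear, put T_s = a + s b, and let # denote the adjoint for ω. For 0 ≤ s ≤ 1 one has ⟨T_s^#
T_s x, x⟩ = |ax|² - s²|bx|² ≥ |ax|² - |bx|² = |x|² (`accretive_gram_twist`). So T_s^# T_s has an
inverse square root N_s, given by a convergent power series, and T_s N_s preserves ω. This map is T
at s = 1, is complex linear at s = 0, and equals T for all s when T is complex linear: a strong
deformation retraction.

Two points concern topologies. The colimit topology on J^S is the operator norm topology because a
complement can be chosen continuously near a given embedding (`continuousAt_localSection`). The
subspace topology on J^U is the right one because its morphism spaces are compact. Essential
surjectivity holds because splitting off symplectic planes shows that every symplectic space is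
isomorphic to some Im V (`exists_hom_imObj`). -/

/-! ### Strong deformation retracts -/

namespace IsWeakHomotopyEquiv

variable {X : Type u₁} {Y : Type u₂} [TopologicalSpace X] [TopologicalSpace Y]

/-- The inclusion of a strong deformation retract is a weak homotopy equivalence. -/
theorem of_deformationRetract (f : C(X, Y)) (r : C(Y, X)) (hr : ∀ x, r (f x) = x)
    (H : C(unitInterval × Y, Y)) (H₀ : ∀ y, H (0, y) = f (r y)) (H₁ : ∀ y, H (1, y) = y)
    (Hf : ∀ t x, H (t, f x) = f x) : IsWeakHomotopyEquiv f where
  bijective_zeroth := by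
    constructor
    · rintro ⟨x⟩ ⟨x'⟩ h
      have h' : Joined (f x) (f x') := Quotient.exact h
      have h'' := h'.map r.continuous
      rw [hr, hr] at h''
      exact Quotient.sound h''
    · rintro ⟨y⟩
      refine ⟨Quotient.mk _ (r y), Quotient.sound ?_⟩
      exact ⟨{ toFun := fun t => H (t, y), continuous_toFun := by fun_prop,
               source' := H₀ y, target' := H₁ y }⟩
  bijective_pi n x _ := by
    constructor
    · rintro ⟨p⟩ ⟨q⟩ h
      have h' : (f.comp p.1).HomotopicRel (f.comp q.1) (Cube.boundary (Fin n)) :=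
        Quotient.exact h
      have h'' := h'.map fun K => K.compContinuousMap r
      have e : ∀ g : C(Fin n → unitInterval, X), r.comp (f.comp g) = g :=
        fun g => ContinuousMap.ext fun t => hr (g t)
      rw [e, e] at h''
      exact Quotient.sound h''
    · rintro ⟨q⟩
      have hq : ∀ t ∈ Cube.boundary (Fin n), q.1 t = f x := q.2
      let p : GenLoop (Fin n) X x :=
        ⟨r.comp q.1, fun t ht => (congrArg r (hq t ht)).trans (hr x)⟩
      refine ⟨Quotient.mk _ p, Quotient.sound ?_⟩
      refine ⟨{ toFun := fun t => H (t.1, q.1 t.2), continuous_toFun := by fun_prop,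
                map_zero_left := fun t => H₀ _, map_one_left := fun t => H₁ _,
                prop' := fun s t ht => ?_ }⟩
      change H (s, q.1 t) = f (r (q.1 t))
      -- On the boundary of the cube q takes the value f x, a point that H never moves, so the
      -- homotopy is relative to the boundary.
      rw [hq t ht, Hf, hr]

end IsWeakHomotopyEquiv

/-! ### Inverse square roots in Banach algebras -/

namespace InvSqrt

variable {R : Type u} [NormedRing R] [NormedAlgebra ℝ R]

/-- The sum of the power series with coefficients `a`. -/
noncomputable def powerSum (a : ℕ → ℝ) (x : R) : R := ∑' n, a n • x ^ n

theorem norm_term_le {a : ℕ → ℝ} (ha : ∀ n, |a n| ≤ 1) (x : R) (n : ℕ) :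
    ‖a n • x ^ n‖ ≤ ‖x ^ n‖ := by
  rw [norm_smul]
  exact mul_le_of_le_one_left (norm_nonneg _) (ha n)

theorem summable_norm {a : ℕ → ℝ} (ha : ∀ n, |a n| ≤ 1) {x : R} (hx : ‖x‖ < 1) :
    Summable fun n => ‖a n • x ^ n‖ :=
  .of_nonneg_of_le (fun _ => norm_nonneg _) (norm_term_le ha x)
    (summable_norm_geometric_of_norm_lt_one hx)

theorem continuousAt_powerSum [CompleteSpace R] {a : ℕ → ℝ} (ha : ∀ n, |a n| ≤ 1)
    {x : R} (hx : ‖x‖ < 1) : ContinuousAt (powerSum a : R → R) x := by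
  obtain ⟨r, hxr, hr⟩ := exists_between hx
  have h0 : 0 ≤ r := (norm_nonneg x).trans hxr.le
  have hc : ContinuousOn (powerSum a : R → R) (Metric.ball 0 r) := by
    -- The factor `max 1 ‖(1 : R)‖` covers the term n = 0, since the norm of 1 in R need not be 1.
    refine continuousOn_tsum (u := fun n => max 1 ‖(1 : R)‖ * r ^ n)
      (fun n => by fun_prop) ((summable_geometric_of_lt_one h0 hr).mul_left _) ?_
    intro n y hy
    refine (norm_term_le ha y n).trans ?_
    have hy' : ‖y‖ ≤ r := by simpa using (mem_ball_zero_iff.1 hy).le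
    rcases n with _ | n
    · simp
    · refine (norm_pow_le' y n.succ_pos).trans ?_
      refine (pow_le_pow_left₀ (norm_nonneg _) hy' _).trans ?_
      exact le_mul_of_one_le_left (pow_nonneg h0 _) (le_max_left _ _)
  exact hc.continuousAt (Metric.isOpen_ball.mem_nhds (by simpa using hxr))

theorem powerSum_commute (a : ℕ → ℝ) {x y : R} (h : Commute y x) : Commute y (powerSum a x) :=
  Commute.tsum_right _ fun n => (h.pow_right n).smul_right (a n)

/-- Meant for the symplectic adjoint, which reverses products; the reversal does not affect powers
of a single element. -/
theorem map_powerSum [CompleteSpace R] {a : ℕ → ℝ} (ha : ∀ n, |a n| ≤ 1)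
    (φ : R →L[ℝ] R) (h₁ : φ 1 = 1) (hφ : ∀ x y, φ (x * y) = φ y * φ x) {x : R}
    (hx : ‖x‖ < 1) : φ (powerSum a x) = powerSum a (φ x) := by
  have hp : ∀ n, φ (x ^ n) = φ x ^ n := by
    intro n
    induction n with
    | zero => simpa using h₁
    | succ n ih => rw [pow_succ, hφ, ih, pow_succ']
  rw [powerSum, φ.map_tsum (summable_norm ha hx).of_norm, powerSum]
  exact tsum_congr fun n => by rw [map_smul, hp]

/-- The coefficients of the square root series, up to normalization. -/
noncomputable def coeff (n : ℕ) : ℝ := catalan n / 4 ^ n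

theorem abs_coeff_le (n : ℕ) : |coeff n| ≤ 1 := by
  have h : catalan n ≤ 4 ^ n := by
    rw [catalan_eq_centralBinom_div]
    exact (Nat.div_le_self _ _).trans (Nat.centralBinom_le_four_pow n)
  rw [coeff, abs_of_nonneg (by positivity), div_le_one (by positivity)]
  exact_mod_cast h

theorem coeff_succ (n : ℕ) :
    ∑ p ∈ Finset.HasAntidiagonal.antidiagonal n, coeff p.1 * coeff p.2 = 4 * coeff (n + 1) := by
  rw [coeff, catalan_succ']
  push_cast
  rw [pow_succ, mul_comm _ (4 : ℝ), ← mul_div_assoc, mul_div_mul_left _ _ four_ne_zero,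
    Finset.sum_div]
  refine Finset.sum_congr rfl fun p hp => ?_
  rw [coeff, coeff, div_mul_div_comm, ← pow_add, Finset.HasAntidiagonal.mem_antidiagonal.1 hp]

/-- The sum is C(x/4) for the Catalan generating function C, and this is the functional equation
C(y) = 1 + y C(y)². -/
theorem powerSum_coeff [CompleteSpace R] {x : R} (hx : ‖x‖ < 1) :
    powerSum coeff x = 1 + (4⁻¹ : ℝ) • (x * (powerSum coeff x * powerSum coeff x)) := by
  have hs := summable_norm (R := R) abs_coeff_le hx
  have hsq : powerSum coeff x * powerSum coeff x = ∑' n, (4 * coeff (n + 1)) • x ^ n := by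
    rw [powerSum, tsum_mul_tsum_eq_tsum_sum_antidiagonal_of_summable_norm hs hs]
    refine tsum_congr fun n => ?_
    rw [← coeff_succ, Finset.sum_smul]
    refine Finset.sum_congr rfl fun p hp => ?_
    rw [smul_mul_smul_comm, ← pow_add, Finset.HasAntidiagonal.mem_antidiagonal.1 hp]
  have hs' : Summable fun n => (4 * coeff (n + 1)) • x ^ n := by
    have h : Summable fun n => coeff (n + 1) • x ^ n :=
      (summable_norm (fun n => abs_coeff_le (n + 1)) hx).of_norm
    simpa only [mul_smul] using h.const_smul (4 : ℝ)
  rw [hsq, ← hs'.tsum_mul_left, ← tsum_const_smul'' (4⁻¹ : ℝ), powerSum, hs.of_norm.tsum_eq_zero_add]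
  simp [coeff, smul_smul, pow_succ']

/-- The inverse square root of `1 - x`. -/
noncomputable def invSqrt (x : R) : R :=
  -- The first factor is √(1 - x), from √(1 - 4y) = 1 - 2y C(y) at y = x/4; the second is the
  -- geometric series (1 - x)⁻¹.
  (1 - (2⁻¹ : ℝ) • (x * powerSum coeff x)) * powerSum (fun _ => 1) x

theorem invSqrt_commute {x y : R} (h : Commute y x) : Commute y (invSqrt x) := by
  refine (Commute.sub_right (Commute.one_right y) ?_).mul_right ?_
  · exact (h.mul_right (powerSum_commute _ h)).smul_right _
  · exact powerSum_commute _ h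

theorem invSqrt_mul_self [CompleteSpace R] {x : R} (hx : ‖x‖ < 1) :
    invSqrt x * invSqrt x * (1 - x) = 1 := by
  have hc : Commute x (powerSum coeff x) := powerSum_commute _ (Commute.refl x)
  have hg : powerSum (fun _ => 1) x * (1 - x) = 1 := by
    simpa [powerSum] using geom_series_mul_neg x hx
  have hg' : (1 - x) * powerSum (fun _ => 1) x = 1 := by
    simpa [powerSum] using mul_neg_geom_series x hx
  set c := powerSum coeff x with hcd
  set g := powerSum (fun _ => 1) x with hgd
  set d := 1 - (2⁻¹ : ℝ) • (x * c) with hd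
  have hxc : x * c * (x * c) = x * (x * (c * c)) := by
    rw [mul_assoc x c, ← mul_assoc c x, ← hc.eq, mul_assoc x c]
  have h4 : (4⁻¹ : ℝ) • (x * (x * (c * c))) = x * c - x := by
    have h := powerSum_coeff hx
    rw [← hcd] at h
    rw [← mul_smul_comm, ← sub_eq_iff_eq_add'.2 h, mul_sub, mul_one]
  -- Expanding gives 1 - xc + x²c²/4, and the functional equation turns x²c²/4 into xc - x.
  have hdd : d * d = 1 - x := by
    rw [hd, sub_mul, one_mul, mul_sub, mul_one, smul_mul_smul_comm, hxc,
      show (2⁻¹ * 2⁻¹ : ℝ) = 4⁻¹ by norm_num, h4]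
    module
  have hgd' : g * d = d * g := by
    have h1 : Commute x d := by
      refine Commute.sub_right (Commute.one_right x) ?_
      exact ((Commute.refl x).mul_right hc).smul_right _
    exact (powerSum_commute _ h1.symm).eq.symm
  change d * g * (d * g) * (1 - x) = 1
  rw [mul_assoc, mul_assoc d g (1 - x), hg, mul_one, mul_assoc, hgd', ← mul_assoc, hdd, hg']

/-- Both factors of `invSqrt x` are power series in x, so they commute and the reversal of their
order by φ is harmless. -/
theorem map_invSqrt [CompleteSpace R] (φ : R →L[ℝ] R) (h₁ : φ 1 = 1)
    (hφ : ∀ x y, φ (x * y) = φ y * φ x) {x : R} (hx : ‖x‖ < 1) (hφx : φ x = x) : φ (invSqrt x) = invSqrt x := by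
  have hc : Commute x (powerSum coeff x) := powerSum_commute _ (Commute.refl x)
  have h1 : Commute x (1 - (2⁻¹ : ℝ) • (x * powerSum coeff x)) :=
    Commute.sub_right (Commute.one_right x) (((Commute.refl x).mul_right hc).smul_right _)
  rw [invSqrt, hφ, map_sub, map_smul, hφ, h₁, map_powerSum abs_coeff_le φ h₁ hφ hx,
    map_powerSum (by simp) φ h₁ hφ hx, hφx, ← hc.eq]
  exact (powerSum_commute _ h1.symm).eq.symm

theorem invSqrt_zero : invSqrt (0 : R) = 1 := by
  have h : powerSum (fun _ => 1) (0 : R) = 1 := by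
    rw [powerSum, tsum_eq_single 0 fun n hn => by simp [hn]]
    simp
  rw [invSqrt, h]
  simp

theorem continuousAt_invSqrt [CompleteSpace R] {x : R} (hx : ‖x‖ < 1) :
    ContinuousAt (invSqrt : R → R) x := by
  have h₁ := continuousAt_powerSum (R := R) abs_coeff_le hx
  have h₂ := continuousAt_powerSum (R := R) (a := fun _ => 1) (by simp) hx
  unfold invSqrt
  fun_prop

end InvSqrt

/-! ### Real linear maps and the imaginary part of the inner product -/

namespace ImForm

open ContinuousLinearMap InvSqrt

attribute [local instance] InnerProductSpace.complexToReal

variable {E : Type*} [NormedAddCommGroup E] [InnerProductSpace ℂ E]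
  {F : Type*} [NormedAddCommGroup F] [InnerProductSpace ℂ F]
  {K : Type*} [NormedAddCommGroup K] [InnerProductSpace ℂ K]

/-- The symplectic form of a complex inner product space. -/
noncomputable def im (x y : E) : ℝ := (inner ℂ x y).im

theorem im_add_left (x y z : E) : im (x + y) z = im x z + im y z := by simp [im]

theorem im_add_right (x y z : E) : im x (y + z) = im x y + im x z := by simp [im]

theorem im_sub_left (x y z : E) : im (x - y) z = im x z - im y z := by simp [im]

theorem im_swap (x y : E) : im x y = -im y x := by
  rw [im, im, ← inner_conj_symm, Complex.conj_im]

theorem im_I_right (x y : E) : im x (Complex.I • y) = inner ℝ x y := by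
  rw [im, inner_smul_right, real_inner_eq_re_inner ℂ]
  simp

theorem im_I_left (x y : E) : im (Complex.I • x) y = -inner ℝ x y := by
  rw [im_swap, im_I_right, real_inner_comm]

theorem im_eq (x y : E) : im x y = -inner ℝ x (Complex.I • y) := by
  rw [← im_I_right, smul_smul]
  simp [im]

theorem im_I_self (x : E) : im x (Complex.I • x) = ‖x‖ ^ 2 := by
  rw [im_I_right, real_inner_self_eq_norm_sq]

theorem ext_im {x y : E} (h : ∀ z, im x z = im y z) : x = y := by
  refine ext_inner_right ℝ fun z => ?_
  rw [← im_I_right, ← im_I_right, h]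

/-- Multiplication by the imaginary unit as a real linear map. -/
noncomputable def mulI (E : Type*) [NormedAddCommGroup E] [InnerProductSpace ℂ E] : E →L[ℝ] E :=
  Complex.I • ContinuousLinearMap.id ℝ E

theorem mulI_apply (x : E) : mulI E x = Complex.I • x := rfl

theorem I_I (x : E) : Complex.I • Complex.I • x = -x := by simp [smul_smul]

/-- A real linear map preserving the imaginary part of the inner product. -/
def IsSymp (T : E →L[ℝ] F) : Prop := ∀ x y, im (T x) (T y) = im x y

/-- A complex linear map, as a property of real linear maps. -/
def IsComplex (T : E →L[ℝ] F) : Prop := ∀ x, T (Complex.I • x) = Complex.I • T x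

/-- The norm is recovered from the symplectic form and the complex structure by |x|² = ω(x, ix). -/
theorem IsSymp.norm_map {T : E →L[ℝ] F} (h : IsSymp T) (hc : IsComplex T) (x : E) :
    ‖T x‖ = ‖x‖ := by
  have := h x (Complex.I • x)
  rw [hc, im_I_self, im_I_self] at this
  exact (pow_left_inj₀ (norm_nonneg _) (norm_nonneg _) two_ne_zero).1 this

theorem smul_eq_re_add_im (c : ℂ) (x : E) : c • x = c.re • x + c.im • Complex.I • x := by
  conv_lhs => rw [← Complex.re_add_im c, add_smul, mul_smul]
  rfl

theorem IsComplex.map_smul {T : E →L[ℝ] F} (h : IsComplex T) (c : ℂ) (x : E) :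
    T (c • x) = c • T x := by
  rw [smul_eq_re_add_im, smul_eq_re_add_im c (T x), map_add, ContinuousLinearMap.map_smul,
    ContinuousLinearMap.map_smul, h]

/-! ### Adjoints for the symplectic form -/

section Adjoint

variable [CompleteSpace E] [CompleteSpace F] [CompleteSpace K]

/-- The adjoint of a real linear map for the symplectic forms. -/
noncomputable def sadj : (E →L[ℝ] F) →L[ℝ] (F →L[ℝ] E) where
  -- Since ω(x, y) = -⟨x, iy⟩, the adjoint for ω is -i T* i.
  toFun T := -(mulI E ∘L adjoint T ∘L mulI F)
  map_add' S T := by simp only [map_add, add_comp, comp_add, neg_add]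
  map_smul' c T := by
    simp only [map_smulₛₗ, smul_comp, comp_smul, RingHom.id_apply]
    simp
  cont := by
    have h : Continuous fun T : E →L[ℝ] F => adjoint T := (adjoint (𝕜 := ℝ)).continuous
    fun_prop

theorem im_sadj_right (T : E →L[ℝ] F) (x : E) (y : F) : im x (sadj T y) = im (T x) y := by
  change im x (-(Complex.I • adjoint T (Complex.I • y))) = _
  rw [im_eq, im_eq, smul_neg, I_I, neg_neg, adjoint_inner_right]

theorem im_sadj_left (T : E →L[ℝ] F) (x : F) (y : E) : im (sadj T x) y = im x (T y) := by
  rw [im_swap, im_sadj_right, ← im_swap]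

theorem sadj_comp (S : F →L[ℝ] K) (T : E →L[ℝ] F) : sadj (S ∘L T) = sadj T ∘L sadj S := by
  ext x
  refine ext_im fun z => ?_
  simp only [im_sadj_left, ContinuousLinearMap.comp_apply]

theorem sadj_sadj (T : E →L[ℝ] F) : sadj (sadj T) = T := by
  ext x
  refine ext_im fun z => ?_
  rw [im_sadj_left, im_sadj_right]

theorem sadj_one : sadj (1 : E →L[ℝ] E) = 1 := by
  ext x
  refine ext_im fun z => ?_
  rw [im_sadj_left]
  rfl

theorem isSymp_iff {T : E →L[ℝ] F} : IsSymp T ↔ sadj T ∘L T = 1 := by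
  constructor
  · intro h
    ext x
    refine ext_im fun z => ?_
    rw [ContinuousLinearMap.comp_apply, im_sadj_left, h]
    rfl
  · intro h x y
    rw [← im_sadj_left, ← ContinuousLinearMap.comp_apply, h]
    rfl

theorem sadj_gram (T : E →L[ℝ] F) : sadj (sadj T ∘L T) = sadj T ∘L T := by
  rw [sadj_comp, sadj_sadj]

/-- If `N` is a self-adjoint inverse square root of the Gram operator of `T`, then `T N`
preserves the symplectic forms. -/
theorem isSymp_comp {T : E →L[ℝ] F} {N : E →L[ℝ] E} (hN : sadj N = N)
    (hc : Commute (sadj T ∘L T) N) (h : N * N * (sadj T ∘L T) = 1) : IsSymp (T ∘L N) := by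
  rw [isSymp_iff, sadj_comp, hN]
  change N * ((sadj T ∘L T) * N) = 1
  rw [hc.eq, ← mul_assoc, h]

theorem sadj_invSqrt {X : E →L[ℝ] E} (hX : ‖X‖ < 1) (h : sadj X = X) :
    sadj (invSqrt X) = invSqrt X :=
  map_invSqrt sadj sadj_one (fun S T => sadj_comp S T) hX h

end Adjoint

/-! ### Normalization of accretive operators -/

section Root

/-- The scaling factor which moves an accretive operator into the domain of convergence. -/
noncomputable def scale (B : E →L[ℝ] E) : ℝ := (max 1 (‖B‖ ^ 2))⁻¹

theorem scale_pos (B : E →L[ℝ] E) : 0 < scale B :=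
  inv_pos.2 (lt_of_lt_of_le one_pos (le_max_left _ _))

/-- The inverse square root of an accretive operator. -/
noncomputable def root (B : E →L[ℝ] E) : E →L[ℝ] E :=
  √(scale B) • invSqrt (1 - scale B • B)

/-- With c = `scale B`, expand |x - cBx|² = |x|² - 2c⟨Bx, x⟩ + c²|Bx|². Accretivity bounds the
middle term by -2c|x|², and c‖B‖² ≤ 1 bounds the last by c|x|², so ‖1 - cB‖² ≤ 1 - c. -/
theorem norm_one_sub_lt {B : E →L[ℝ] E} (hB : ∀ x, ‖x‖ ^ 2 ≤ inner ℝ (B x) x) :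
    ‖1 - scale B • B‖ < 1 := by
  set c := scale B with hc
  have hc0 : 0 < c := scale_pos B
  have hcB : c * ‖B‖ ^ 2 ≤ 1 := by
    rw [hc, scale, inv_mul_le_one₀ (lt_of_lt_of_le one_pos (le_max_left _ _))]
    exact le_max_right _ _
  have hc1 : c ≤ 1 := inv_le_one_of_one_le₀ (le_max_left _ _)
  have h : ‖1 - c • B‖ ≤ √(1 - c) := by
    refine opNorm_le_bound _ (Real.sqrt_nonneg _) fun x => ?_
    have h1 : ‖x - c • B x‖ ^ 2 ≤ (1 - c) * ‖x‖ ^ 2 := by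
      rw [norm_sub_sq_real, inner_smul_right, real_inner_comm, norm_smul, mul_pow,
        Real.norm_of_nonneg hc0.le]
      have h2 : ‖B x‖ ^ 2 ≤ ‖B‖ ^ 2 * ‖x‖ ^ 2 := by
        rw [← mul_pow]
        exact pow_le_pow_left₀ (norm_nonneg _) (B.le_opNorm x) 2
      have h3 : c ^ 2 * ‖B x‖ ^ 2 ≤ c * ‖x‖ ^ 2 := by
        calc c ^ 2 * ‖B x‖ ^ 2 ≤ c ^ 2 * (‖B‖ ^ 2 * ‖x‖ ^ 2) := by gcongr
          _ = c * (c * ‖B‖ ^ 2) * ‖x‖ ^ 2 := by ring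
          _ ≤ c * 1 * ‖x‖ ^ 2 := by gcongr
          _ = c * ‖x‖ ^ 2 := by ring
      have h4 := mul_le_mul_of_nonneg_left (hB x) hc0.le
      linarith
    change ‖x - c • B x‖ ≤ _
    rw [← Real.sqrt_sq (norm_nonneg (x - c • B x))]
    refine (Real.sqrt_le_sqrt h1).trans_eq ?_
    rw [Real.sqrt_mul (by linarith), Real.sqrt_sq (norm_nonneg _)]
  refine h.trans_lt ?_
  rw [Real.sqrt_lt' one_pos]
  linarith

theorem root_commute {B S : E →L[ℝ] E} (h : Commute S B) : Commute S (root B) := by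
  refine Commute.smul_right (invSqrt_commute ?_) _
  exact Commute.sub_right (Commute.one_right S) (h.smul_right _)

/-- The maximum with 1 in `scale` gives scaling factor 1 here, even when E = 0. This is what makes
the deformation fix the maps it should fix. -/
theorem root_one : root (1 : E →L[ℝ] E) = 1 := by
  have h : scale (1 : E →L[ℝ] E) = 1 := by
    rw [scale, max_eq_left, inv_one]
    exact pow_le_one₀ (norm_nonneg _) norm_id_le
  rw [root, h, one_smul, sub_self, invSqrt_zero, Real.sqrt_one, one_smul]

variable [CompleteSpace E]

theorem root_mul_self {B : E →L[ℝ] E} (hB : ∀ x, ‖x‖ ^ 2 ≤ inner ℝ (B x) x) :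
    root B * root B * B = 1 := by
  have h := invSqrt_mul_self (norm_one_sub_lt hB)
  rw [sub_sub_cancel, mul_smul_comm] at h
  rw [root, smul_mul_smul_comm, Real.mul_self_sqrt (scale_pos B).le, smul_mul_assoc, h]

theorem sadj_root {B : E →L[ℝ] E} (hB : ∀ x, ‖x‖ ^ 2 ≤ inner ℝ (B x) x) (h : sadj B = B) :
    sadj (root B) = root B := by
  rw [root, map_smul, sadj_invSqrt (norm_one_sub_lt hB)]
  rw [map_sub, sadj_one, map_smul, h]

theorem continuousAt_root {B : E →L[ℝ] E} (hB : ∀ x, ‖x‖ ^ 2 ≤ inner ℝ (B x) x) :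
    ContinuousAt (root : (E →L[ℝ] E) → _) B := by
  have hs : Continuous (scale : (E →L[ℝ] E) → ℝ) := by
    unfold scale
    refine Continuous.inv₀ (by fun_prop) fun B => ?_
    exact (lt_of_lt_of_le one_pos (le_max_left _ _)).ne'
  have h1 : ContinuousAt (fun B : E →L[ℝ] E => invSqrt (1 - scale B • B)) B :=
    ContinuousAt.comp (g := invSqrt) (continuousAt_invSqrt (norm_one_sub_lt hB))
      (Continuous.continuousAt (by fun_prop))
  exact (Real.continuous_sqrt.comp hs).continuousAt.smul h1

end Root

/-! ### The deformation of symplectic maps onto complex linear isometries -/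

section Deform

/-- The real linear map whose complex linear part is that of `T` and whose antilinear part is `s`
times that of `T`. -/
noncomputable def twist (s : ℝ) (T : E →L[ℝ] F) : E →L[ℝ] F :=
  (2⁻¹ : ℝ) • (T - mulI F ∘L T ∘L mulI E) + s • (2⁻¹ : ℝ) • (T + mulI F ∘L T ∘L mulI E)

theorem twist_one (T : E →L[ℝ] F) : twist 1 T = T := by
  unfold twist
  module

theorem twist_of_isComplex {T : E →L[ℝ] F} (hT : IsComplex T) (s : ℝ) : twist s T = T := by
  have h : mulI F ∘L T ∘L mulI E = -T := by
    ext x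
    change Complex.I • T (Complex.I • x) = -T x
    rw [hT, I_I]
  rw [twist, h]
  module

theorem isComplex_twist_zero (T : E →L[ℝ] F) : IsComplex (twist 0 T) := by
  intro x
  simp only [twist, zero_smul, add_zero, smul_apply, sub_apply, ContinuousLinearMap.comp_apply,
    mulI_apply, I_I,
    map_neg, smul_neg, smul_sub, smul_comm Complex.I (2⁻¹ : ℝ)]
  module

/-- With a and b the linear and antilinear parts of T at x, the twist sends x to a + sb and ix to
i(a - sb), and ω(u, iv) = ⟨u, v⟩; the cross terms cancel. -/
theorem im_twist (s : ℝ) (T : E →L[ℝ] F) (x : E) :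
    im (twist s T x) (twist s T (Complex.I • x)) =
      ‖(2⁻¹ : ℝ) • (T x - Complex.I • T (Complex.I • x))‖ ^ 2 -
        s ^ 2 * ‖(2⁻¹ : ℝ) • (T x + Complex.I • T (Complex.I • x))‖ ^ 2 := by
  set a := (2⁻¹ : ℝ) • (T x - Complex.I • T (Complex.I • x)) with ha
  set b := (2⁻¹ : ℝ) • (T x + Complex.I • T (Complex.I • x)) with hb
  have h1 : twist s T x = a + s • b := rfl
  have h2 : twist s T (Complex.I • x) = Complex.I • (a - s • b) := by
    simp only [twist, ha, hb, add_apply, smul_apply, sub_apply, ContinuousLinearMap.comp_apply,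
    mulI_apply, I_I,
      map_neg, smul_neg, smul_sub, smul_add, smul_comm Complex.I (2⁻¹ : ℝ), smul_comm Complex.I s]
    module
  rw [h1, h2, im_I_right]
  simp only [inner_add_left, inner_sub_right, inner_smul_left, inner_smul_right,
    real_inner_self_eq_norm_sq, real_inner_comm a b, RCLike.conj_to_real]
  ring

/-- The right side is |a|² - s²|b|², which decreases as s² grows, and at s = 1 it equals ω(Tx,
T(ix)) = ω(x, ix) = |x|². -/
theorem accretive_gram_twist [CompleteSpace E] [CompleteSpace F] {s : ℝ} (hs : s ^ 2 ≤ 1)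
    {T : E →L[ℝ] F} (hT : IsSymp T) (x : E) :
    ‖x‖ ^ 2 ≤ inner ℝ ((sadj (twist s T) ∘L twist s T) x) x := by
  rw [← im_I_right, ContinuousLinearMap.comp_apply, im_sadj_left, im_twist, ← im_I_self, ← hT]
  have h := im_twist 1 T x
  rw [twist_one] at h
  rw [h, one_pow]
  gcongr

variable [CompleteSpace E] [CompleteSpace F]

/-- The deformation at time `s`. -/
noncomputable def deform (s : ℝ) (T : E →L[ℝ] F) : E →L[ℝ] F :=
  twist s T ∘L root (sadj (twist s T) ∘L twist s T)

theorem isSymp_deform {s : ℝ} (hs : s ^ 2 ≤ 1) {T : E →L[ℝ] F} (hT : IsSymp T) :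
    IsSymp (deform s T) :=
  isSymp_comp (sadj_root (accretive_gram_twist hs hT) (sadj_gram _)) (root_commute (Commute.refl _))
    (root_mul_self (accretive_gram_twist hs hT))

theorem deform_one {T : E →L[ℝ] F} (hT : IsSymp T) : deform 1 T = T := by
  rw [deform, twist_one, isSymp_iff.1 hT, root_one]
  rfl

theorem deform_of_isComplex {T : E →L[ℝ] F} (hT : IsSymp T) (hc : IsComplex T) (s : ℝ) :
    deform s T = T := by
  rw [deform, twist_of_isComplex hc, isSymp_iff.1 hT, root_one]
  rfl

/-- The Gram operator of a complex linear map commutes with i, hence so does its inverse square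
root. -/
theorem isComplex_deform_zero (T : E →L[ℝ] F) : IsComplex (deform 0 T) := by
  have h := isComplex_twist_zero T
  set S := twist 0 T with hS
  -- Paired with z under ω, both sides become -⟨Sx, Sz⟩.
  have h1 : IsComplex (sadj S ∘L S) := by
    intro x
    refine ext_im fun z => ?_
    rw [ContinuousLinearMap.comp_apply, im_sadj_left, h, im_I_left,
      ContinuousLinearMap.comp_apply, im_I_left, real_inner_comm,
      ← neg_inj, neg_neg, neg_neg, ← im_I_right (sadj S (S x)), im_sadj_left, h, im_I_right,
      real_inner_comm]
  have h2 : Commute (mulI E) (sadj S ∘L S) := by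
    ext x
    exact (h1 x).symm
  intro x
  have h3 := DFunLike.congr_fun (root_commute h2).eq x
  rw [deform, ← hS, ContinuousLinearMap.comp_apply, ContinuousLinearMap.comp_apply, ← h]
  exact congrArg S h3.symm

theorem continuousAt_deform {s : ℝ} (hs : s ^ 2 ≤ 1) {T : E →L[ℝ] F} (hT : IsSymp T) :
    ContinuousAt (fun p : ℝ × (E →L[ℝ] F) => deform p.1 p.2) (s, T) := by
  have h1 : Continuous fun p : ℝ × (E →L[ℝ] F) => twist p.1 p.2 := by
    unfold twist
    fun_prop
  have h2 : ContinuousAt (fun p : ℝ × (E →L[ℝ] F) =>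
      root (sadj (twist p.1 p.2) ∘L twist p.1 p.2)) (s, T) :=
    ContinuousAt.comp (g := root) (continuousAt_root (accretive_gram_twist hs hT))
      (Continuous.continuousAt (by fun_prop))
  exact h1.continuousAt.clm_comp h2

end Deform

end ImForm

/-! ### Complements of the image of a symplectic map -/

namespace ImForm

open ContinuousLinearMap InvSqrt

variable {E : Type*} [NormedAddCommGroup E] [InnerProductSpace ℂ E]
  {F : Type*} [NormedAddCommGroup F] [InnerProductSpace ℂ F]
  {K : Type*} [NormedAddCommGroup K] [InnerProductSpace ℂ K]
  [CompleteSpace E] [CompleteSpace F]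

/-- The projection of `D` to the symplectic complement of the image of `T`. -/
noncomputable def compl (D : K →L[ℝ] F) (T : E →L[ℝ] F) : K →L[ℝ] F :=
  D - T ∘L sadj T ∘L D

theorem continuous_compl (D : K →L[ℝ] F) :
    Continuous fun T : E →L[ℝ] F => compl D T := by
  unfold compl
  fun_prop

/-- For symplectic T the operator T T^# is the symplectic projection onto the image of T. -/
theorem im_compl (D : K →L[ℝ] F) {T : E →L[ℝ] F} (hT : IsSymp T) (x : K) (v : E) :
    im (compl D T x) (T v) = 0 := by
  change im (D x - T (sadj T (D x))) (T v) = 0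
  rw [im_sub_left, hT, im_sadj_left, sub_self]

theorem compl_eq_self {D : K →L[ℝ] F} {T : E →L[ℝ] F} (h : ∀ x v, im (D x) (T v) = 0) :
    compl D T = D := by
  have h' : ∀ x, sadj T (D x) = 0 := fun x => ext_im fun v => by
    rw [im_sadj_left, h]
    simp [im]
  ext x
  change D x - T (sadj T (D x)) = D x
  rw [h', map_zero, sub_zero]

variable [CompleteSpace K]

/-- The Gram operator of the projection of `D` to the complement of the image of `T`. -/
noncomputable def complGram (D : K →L[ℝ] F) (T : E →L[ℝ] F) : K →L[ℝ] K :=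
  sadj (compl D T) ∘L compl D T

theorem continuous_complGram (D : K →L[ℝ] F) :
    Continuous fun T : E →L[ℝ] F => complGram D T := by
  have h := continuous_compl (E := E) D
  unfold complGram
  fun_prop

/-- The normalized projection of `D` to the symplectic complement of the image of `T`. -/
noncomputable def complSymp (D : K →L[ℝ] F) (T : E →L[ℝ] F) : K →L[ℝ] F :=
  compl D T ∘L invSqrt (1 - complGram D T)

theorem im_complSymp (D : K →L[ℝ] F) {T : E →L[ℝ] F} (hT : IsSymp T) (x : K) (v : E) :
    im (complSymp D T x) (T v) = 0 :=
  im_compl D hT _ v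

theorem isSymp_complSymp {D : K →L[ℝ] F} {T : E →L[ℝ] F} (h : ‖1 - complGram D T‖ < 1) :
    IsSymp (complSymp D T) := by
  refine isSymp_comp (sadj_invSqrt h ?_) ?_ ?_
  · rw [map_sub, sadj_one, complGram, sadj_gram]
  · exact invSqrt_commute (Commute.sub_right (Commute.one_right _) (Commute.refl _))
  · have := invSqrt_mul_self h
    rwa [sub_sub_cancel] at this

theorem one_sub_complGram {D : K →L[ℝ] F} (hD : IsSymp D) {T : E →L[ℝ] F}
    (h : ∀ x v, im (D x) (T v) = 0) : 1 - complGram D T = 0 := by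
  rw [complGram, compl_eq_self h, isSymp_iff.1 hD, sub_self]

/-- When D already lands in the complement of T, its Gram operator there is the identity. By
continuity, embeddings near T keep it in the domain of the inverse square root, so D can be carried
to a symplectic frame of their complements. -/
theorem eventually_norm_lt {D : K →L[ℝ] F} (hD : IsSymp D) {T : E →L[ℝ] F}
    (h : ∀ x v, im (D x) (T v) = 0) : ∀ᶠ S in nhds T, ‖1 - complGram D S‖ < 1 := by
  have hc : Continuous fun S : E →L[ℝ] F => ‖1 - complGram D S‖ :=
    (continuous_const.sub (continuous_complGram D)).norm
  refine hc.continuousAt.eventually_lt continuousAt_const ?_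
  rw [one_sub_complGram hD h, norm_zero]
  exact one_pos

theorem continuousAt_complSymp {D : K →L[ℝ] F} (hD : IsSymp D) {T : E →L[ℝ] F}
    (h : ∀ x v, im (D x) (T v) = 0) : ContinuousAt (fun S : E →L[ℝ] F => complSymp D S) T := by
  have h1 : ContinuousAt (fun S : E →L[ℝ] F => invSqrt (1 - complGram D S)) T := by
    refine ContinuousAt.comp (g := invSqrt) (continuousAt_invSqrt ?_)
      (continuous_const.sub (continuous_complGram D)).continuousAt
    rw [one_sub_complGram hD h, norm_zero]
    exact one_pos
  exact (continuous_compl D).continuousAt.clm_comp h1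

end ImForm

/-! ### Symplectic embeddings and their complements -/

namespace SymplecticSpace

open Module

variable {A B X X' : SymplecticSpace.{u}}

/-- A linear map preserving the symplectic forms. -/
def Preserves (T : A →ₗ[ℝ] B) : Prop := ∀ x y, B.form (T x) (T y) = A.form x y

theorem Preserves.injective {T : A →ₗ[ℝ] B} (hT : Preserves T) : Function.Injective T := by
  refine (injective_iff_map_eq_zero T).2 fun x hx => A.nondegenerate.1 x fun y => ?_
  rw [← hT, hx, map_zero, LinearMap.zero_apply]

/-- A linear map preserving the symplectic forms between spaces of equal dimension is a
symplectic isomorphism. -/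
noncomputable def homOfPreserves (T : A →ₗ[ℝ] B) (hT : Preserves T)
    (hd : finrank ℝ A = finrank ℝ B) : A ⟶ B :=
  Iso.mk (LinearEquiv.ofInjectiveOfFinrankEq T hT.injective hd) hT

theorem toEquiv_homOfPreserves (T : A →ₗ[ℝ] B) (hT : Preserves T)
    (hd : finrank ℝ A = finrank ℝ B) (x : A) : toEquiv (homOfPreserves T hT hd) x = T x := rfl

theorem form_toEquiv (f : A ⟶ B) (x y : A) :
    B.form (toEquiv f x) (toEquiv f y) = A.form x y := Iso.map_form f x y

theorem finrank_eq (f : A ⟶ B) : finrank ℝ A = finrank ℝ B := (toEquiv f).finrank_eq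

theorem finrank_tensor (X A : SymplecticSpace.{u}) :
    finrank ℝ (X ⊗ A : SymplecticSpace.{u}) = finrank ℝ X + finrank ℝ A :=
  Module.finrank_prod (R := ℝ) (M := X) (M' := A)

/-- A morphism out of a direct sum as a function on pairs. -/
def app (f : X ⊗ A ⟶ B) : X × A →ₗ[ℝ] B := toLin f

/-- A morphism out of a direct sum as a linear isomorphism from the space of pairs. -/
def appEquiv (f : X ⊗ A ⟶ B) : (X × A) ≃ₗ[ℝ] B := toEquiv f

theorem form_app (f : X ⊗ A ⟶ B) (p q : X × A) :
    B.form (app f p) (app f q) = X.form p.1 q.1 + A.form p.2 q.2 := Iso.map_form f p q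

theorem app_whiskerRight (g : X ⟶ X') (f : X' ⊗ A ⟶ B) (p : X × A) :
    app (g ▷ A ≫ f) p = app f (toEquiv g p.1, p.2) := rfl

theorem hom_ext_app {f g : X ⊗ A ⟶ B} (h : ∀ p, app f p = app g p) : f = g := hom_ext h

/-- The restriction of `f : X ⊗ A ⟶ B` to `A`. -/
def restr (f : X ⊗ A ⟶ B) : A →ₗ[ℝ] B := app f ∘ₗ LinearMap.inr ℝ X A

theorem restr_apply (f : X ⊗ A ⟶ B) (a : A) : restr f a = app f (0, a) := rfl

theorem preserves_restr (f : X ⊗ A ⟶ B) : Preserves (restr f) := fun x y => by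
  rw [restr_apply, restr_apply, form_app]
  simp

theorem restr_whiskerRight (g : X ⟶ X') (f : X' ⊗ A ⟶ B) : restr (g ▷ A ≫ f) = restr f := by
  ext a
  rw [restr_apply, restr_apply, app_whiskerRight]
  simp

/-- The composite f'⁻¹ f preserves the form and fixes A pointwise, so it carries X, the symplectic
complement of A, to X'. -/
theorem exists_hom_of_restr_eq (f : X ⊗ A ⟶ B) (f' : X' ⊗ A ⟶ B) (h : restr f = restr f') :
    ∃ g : X ⟶ X', g ▷ A ≫ f' = f := by
  let k : (X × A) ≃ₗ[ℝ] (X' × A) := (appEquiv f).trans (appEquiv f').symm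
  have hk : ∀ p, app f' (k p) = app f p := fun p => (appEquiv f').apply_symm_apply _
  have hform : ∀ p q, X'.form (k p).1 (k q).1 + A.form (k p).2 (k q).2 =
      X.form p.1 q.1 + A.form p.2 q.2 := fun p q => by rw [← form_app f', hk, hk, form_app]
  have hA : ∀ a, k (0, a) = (0, a) := fun a =>
    (appEquiv f').injective ((hk (0, a)).trans (DFunLike.congr_fun h a))
  -- The A-component of k(x, 0) pairs to zero with every a, because k fixes (0, a) and (x, 0) is
  -- orthogonal to it.
  have hX : ∀ x, (k (x, 0)).2 = 0 := fun x => by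
    refine A.nondegenerate.1 _ fun a => ?_
    have := hform (x, 0) (0, a)
    rw [hA] at this
    simpa using this
  let T : X →ₗ[ℝ] X' := LinearMap.fst ℝ X' A ∘ₗ k.toLinearMap ∘ₗ LinearMap.inl ℝ X A
  have hT : Preserves T := fun x y => by
    have := hform (x, 0) (y, 0)
    rw [hX, hX] at this
    simp only [map_zero, add_zero] at this
    exact this
  have hd : finrank ℝ X = finrank ℝ X' := by
    have h1 := (finrank_eq f).trans (finrank_eq f').symm
    rw [finrank_tensor, finrank_tensor] at h1
    exact Nat.add_right_cancel h1
  refine ⟨homOfPreserves T hT hd, hom_ext_app fun p => ?_⟩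
  rw [app_whiskerRight, ← hk]
  congr 1
  have hp : k p = k (p.1, 0) + k (0, p.2) := by rw [← map_add]; simp
  rw [hp, hA]
  refine Prod.ext ?_ ?_
  · simp [toEquiv_homOfPreserves, T]
  · simp [hX]

/-- The adjoint of a linear map for the symplectic forms. -/
theorem exists_adjoint (T : A →ₗ[ℝ] B) :
    ∃ σ : B →ₗ[ℝ] A, ∀ b a, A.form (σ b) a = B.form b (T a) := by
  have hi : Function.Injective A.form :=
    (injective_iff_map_eq_zero A.form).2 fun x hx =>
      A.nondegenerate.1 x fun y => by rw [hx, LinearMap.zero_apply]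
  let e : A ≃ₗ[ℝ] (A →ₗ[ℝ] ℝ) :=
    LinearEquiv.ofInjectiveOfFinrankEq A.form hi Subspace.dual_finrank_eq.symm
  refine ⟨e.symm.toLinearMap ∘ₗ (B.form.compl₁₂ LinearMap.id T), fun b a => ?_⟩
  exact DFunLike.congr_fun (e.apply_symm_apply (B.form.compl₁₂ LinearMap.id T b)) a

/-- Every symplectic embedding is the restriction of an isomorphism out of a direct sum. -/
theorem exists_restr_eq {T : A →ₗ[ℝ] B} (hT : Preserves T) :
    ∃ (X : SymplecticSpace.{u}) (f : X ⊗ A ⟶ B), restr f = T := by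
  obtain ⟨σ, hσ⟩ := exists_adjoint T
  -- As σ is a left inverse of T, B splits as ker σ ⊕ T(A), and ker σ is the symplectic complement
  -- of T(A); it serves as X.
  have hσT : ∀ a, σ (T a) = a := fun a => by
    refine sub_eq_zero.1 (A.nondegenerate.1 _ fun y => ?_)
    rw [map_sub, LinearMap.sub_apply, hσ, hT, sub_self]
  have h0 : ∀ n ∈ LinearMap.ker σ, ∀ a, B.form n (T a) = 0 := fun n hn a => by
    rw [← hσ, LinearMap.mem_ker.1 hn, map_zero, LinearMap.zero_apply]
  have h0' : ∀ n ∈ LinearMap.ker σ, ∀ a, B.form (T a) n = 0 := fun n hn a => by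
    rw [← B.isAlt.neg, h0 n hn, neg_zero]
  have hmem : ∀ b, b - T (σ b) ∈ LinearMap.ker σ := fun b => by
    rw [LinearMap.mem_ker, map_sub, hσT, sub_self]
  have hnd : ∀ n ∈ LinearMap.ker σ, (∀ m ∈ LinearMap.ker σ, B.form n m = 0) → n = 0 :=
    fun n hn h => B.nondegenerate.1 n fun b => by
      rw [← sub_add_cancel b (T (σ b)), map_add, h _ (hmem b), h0 n hn, add_zero]
  let X : SymplecticSpace.{u} :=
    { carrier := LinearMap.ker σ
      form := B.form.compl₁₂ (LinearMap.ker σ).subtype (LinearMap.ker σ).subtype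
      isAlt := fun x => B.isAlt x.1
      nondegenerate := by
        refine ⟨fun x h => Subtype.ext (hnd x.1 x.2 fun m hm => h ⟨m, hm⟩),
          fun x h => Subtype.ext (hnd x.1 x.2 fun m hm => ?_)⟩
        rw [← B.isAlt.neg, neg_eq_zero]
        exact h ⟨m, hm⟩ }
  let e : (LinearMap.ker σ × A) ≃ₗ[ℝ] B :=
    { LinearMap.coprod (LinearMap.ker σ).subtype T with
      invFun := fun b => (⟨b - T (σ b), hmem b⟩, σ b)
      left_inv := fun p => by
        have h1 : σ p.1.1 = 0 := p.1.2
        refine Prod.ext (Subtype.ext ?_) ?_ <;> simp [h1, hσT]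
      right_inv := fun b => by simp }
  refine ⟨X, Iso.mk (V := prod X A) (W := B) e fun p q => ?_, ?_⟩
  · change B.form (p.1.1 + T p.2) (q.1.1 + T q.2) = B.form p.1.1 q.1.1 + A.form p.2 q.2
    rw [map_add, map_add, LinearMap.add_apply, LinearMap.add_apply, hT, h0 _ p.1.2, h0' _ q.1.2]
    ring
  · ext a
    change (0 : B) + T a = T a
    exact zero_add _

/-! ### Hermitian models of symplectic spaces -/

theorem inner_euclideanSpace_punit (z w : EuclideanSpace ℂ PUnit.{u + 1}) :
    inner ℂ z w = inner ℂ (z PUnit.unit) (w PUnit.unit) := by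
  simp [PiLp.inner_apply]

open HermitianSpace in
/-- Every symplectic vector space is isomorphic to one coming from a Hermitian space. -/
theorem exists_hom_imObj (W : SymplecticSpace.{u}) :
    ∃ V : HermitianSpace.{u}, Nonempty (imObj V ⟶ W) := by
  induction hn : finrank ℝ W using Nat.strong_induction_on generalizing W with
  | _ n ih =>
  rcases Nat.eq_zero_or_pos n with rfl | hpos
  · have : Subsingleton W := finrank_zero_iff.1 hn
    let V : HermitianSpace.{u} := ⟨EuclideanSpace ℂ PEmpty.{u + 1}⟩
    have : Subsingleton V := inferInstanceAs (Subsingleton (EuclideanSpace ℂ PEmpty.{u + 1}))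
    have : Subsingleton (imObj V) := this
    refine ⟨V, ⟨homOfPreserves (A := imObj V) 0 (fun x y => ?_) ?_⟩⟩
    · rw [Subsingleton.elim x 0]
      simp
    · rw [hn]
      exact finrank_zero_of_subsingleton
  · have : Nontrivial W := nontrivial_of_finrank_pos (R := ℝ) (hn ▸ hpos)
    obtain ⟨x, hx⟩ := exists_ne (0 : W)
    obtain ⟨y, hy⟩ : ∃ y, W.form x y ≠ 0 := by
      by_contra! h
      exact hx (W.nondegenerate.1 x h)
    let L : HermitianSpace.{u} := ⟨EuclideanSpace ℂ PUnit.{u + 1}⟩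
    let c : EuclideanSpace ℂ PUnit.{u + 1} →ₗ[ℝ] ℂ :=
      (EuclideanSpace.proj (𝕜 := ℂ) PUnit.unit).toLinearMap.restrictScalars ℝ
    -- A copy of Im ℂ in W: 1 goes to x and i to y/ω(x, y), which matches Im⟨1, i⟩ = 1.
    let T : imObj L →ₗ[ℝ] W :=
      (Complex.reLm ∘ₗ c).smulRight x +
        (Complex.imLm ∘ₗ c).smulRight ((W.form x y)⁻¹ • y)
    have hT : Preserves T := fun z w => by
      have hxx : W.form x x = 0 := W.isAlt x
      have hyy : W.form y y = 0 := W.isAlt y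
      have hyx : W.form y x = -W.form x y := (W.isAlt.neg x y).symm
      have hf : (imObj L).form z w = (inner ℂ (c z) (c w)).im :=
        congrArg Complex.im (inner_euclideanSpace_punit z w)
      rw [hf]
      change W.form ((c z).re • x + (c z).im • (W.form x y)⁻¹ • y)
        ((c w).re • x + (c w).im • (W.form x y)⁻¹ • y) = _
      simp only [map_add, map_smul, LinearMap.add_apply, LinearMap.smul_apply, hxx, hyy, hyx,
        smul_eq_mul, RCLike.inner_apply, Complex.mul_im, Complex.conj_re, Complex.conj_im]
      field_simp
      ring
    -- The complement of this plane has smaller dimension, so induction gives it a Hermitian model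
    -- V, and V ⊕ ℂ is a model of W.
    obtain ⟨X, f, -⟩ := exists_restr_eq hT
    have hL : 0 < finrank ℝ (imObj L) := by
      have h1 : finrank ℝ (EuclideanSpace ℂ PUnit.{u + 1}) = 2 := by
        rw [finrank_real_of_complex, finrank_euclideanSpace]
        simp
      have h2 : finrank ℝ (imObj L) = 2 := h1
      omega
    have hX := finrank_eq f
    rw [finrank_tensor] at hX
    obtain ⟨V, ⟨g⟩⟩ := ih (finrank ℝ X) (by omega) X rfl
    exact ⟨V ⊗ L, ⟨Functor.OplaxMonoidal.δ imFunctor V L ≫ g ▷ imObj L ≫ f⟩⟩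

end SymplecticSpace

theorem SymplecticSpace.continuous_toLin (A B : SymplecticSpace.{u}) :
    @Continuous _ _ _ (moduleTopology ℝ _) (toLin : (A ⟶ B) → (A →ₗ[ℝ] B)) :=
  continuous_induced_dom (t := moduleTopology ℝ _)

/-! ### Morphism spaces of the symplectic bracket as spaces of symplectic embeddings -/

namespace HermitianSpace

open SymplecticSpace ImForm QuillenBracket

instance completeSpace (V : HermitianSpace.{u}) : CompleteSpace V := FiniteDimensional.complete ℂ V

/-- A linear map between underlying symplectic spaces as a continuous linear map. -/
noncomputable def clmOfLin {V W : HermitianSpace.{u}} (T : imObj V →ₗ[ℝ] imObj W) : V →L[ℝ] W :=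
  LinearMap.toContinuousLinearMap (E := V) (F' := W) T

variable (V W : HermitianSpace.{u})

/-- The space of symplectic linear embeddings. -/
abbrev SympEmb := {T : V →L[ℝ] W // IsSymp T}

variable {V W}

/-- The restriction of `f : X ⊗ Im V ⟶ Im W` to `V`. -/
noncomputable def restrEmb {X : SymplecticSpace.{u}} (f : X ⊗ imObj V ⟶ imObj W) : SympEmb V W :=
  ⟨clmOfLin (restr f), fun x y => preserves_restr f x y⟩

theorem restrEmb_eq_iff {X X' : SymplecticSpace.{u}} (f : X ⊗ imObj V ⟶ imObj W)
    (f' : X' ⊗ imObj V ⟶ imObj W) : restrEmb f = restrEmb f' ↔ restr f = restr f' := by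
  refine ⟨fun h => ?_, fun h => Subtype.ext (congrArg clmOfLin h)⟩
  ext x
  exact DFunLike.congr_fun (congrArg Subtype.val h) x

theorem continuous_restrEmb (X : SymplecticSpace.{u}) :
    Continuous (restrEmb : (X ⊗ imObj V ⟶ imObj W) → SympEmb V W) := by
  refine Continuous.subtype_mk ?_ _
  let _ : TopologicalSpace (X × V →ₗ[ℝ] W) := moduleTopology ℝ _
  have _ : IsModuleTopology ℝ (X × V →ₗ[ℝ] W) := ⟨rfl⟩
  let L : (X × V →ₗ[ℝ] W) →ₗ[ℝ] (V →L[ℝ] W) :=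
    { toFun := fun T => LinearMap.toContinuousLinearMap (T ∘ₗ LinearMap.inr ℝ X V)
      map_add' := fun _ _ => rfl
      map_smul' := fun _ _ => rfl }
  exact (IsModuleTopology.continuous_of_linearMap L).comp
    (continuous_toLin (X ⊗ imObj V) (imObj W))

variable (V W) in
/-- The symplectic embedding given by a morphism of the bracket construction. -/
noncomputable def embOfHom :
    ((⟨imObj V⟩ : SymplecticJ.{u}) ⟶ (⟨imObj W⟩ : SymplecticJ.{u})) → SympEmb V W :=
  Quotient.lift (fun p => restrEmb p.2) fun p q ⟨g, hg⟩ => by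
    rw [← hg, restrEmb_eq_iff]
    exact restr_whiskerRight g q.2

theorem embOfHom_cls {X : SymplecticSpace.{u}} (f : X ⊗ imObj V ⟶ imObj W) :
    embOfHom V W (cls X f) = restrEmb f := rfl

theorem continuous_embOfHom : Continuous (embOfHom V W) :=
  Continuous.quotient_lift (continuous_sigma continuous_restrEmb) _

/-- Injectivity is uniqueness of the complement of an embedding, surjectivity its existence. -/
theorem bijective_embOfHom : Function.Bijective (embOfHom V W) := by
  constructor
  · rintro ⟨X, f⟩ ⟨X', f'⟩ h
    obtain ⟨g, hg⟩ := exists_hom_of_restr_eq f f' ((restrEmb_eq_iff f f').1 h)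
    exact cls_eq g hg
  · rintro ⟨T, hT⟩
    obtain ⟨X, f, hf⟩ := exists_restr_eq (A := imObj V) (B := imObj W) (T := T.toLinearMap) hT
    refine ⟨cls X f, Subtype.ext ?_⟩
    rw [embOfHom_cls]
    ext x
    exact DFunLike.congr_fun hf x

/-- A Hermitian structure on the complement supplies the norm that the inverse square root series
needs. -/
theorem exists_cls_imObj (p : (⟨imObj V⟩ : SymplecticJ.{u}) ⟶ (⟨imObj W⟩ : SymplecticJ.{u})) :
    ∃ (U : HermitianSpace.{u}) (f : imObj U ⊗ imObj V ⟶ imObj W), p = cls (imObj U) f := by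
  obtain ⟨X, f⟩ := p
  obtain ⟨U, ⟨g⟩⟩ := exists_hom_imObj X
  exact ⟨U, g ▷ imObj V ≫ f, (cls_eq g rfl).symm⟩

/-! ### Local sections of the restriction map -/

section LocalSection

variable {U : HermitianSpace.{u}} (f : imObj U ⊗ imObj V ⟶ imObj W)

/-- The restriction of `f : Im U ⊗ Im V ⟶ Im W` to `U`. -/
noncomputable def restrLeft : U →L[ℝ] W := clmOfLin (app f ∘ₗ LinearMap.inl ℝ (imObj U) (imObj V))

theorem isSymp_restrLeft : IsSymp (restrLeft f) := fun x y => by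
  refine (form_app f ((x, 0) : imObj U × imObj V) ((y, 0) : imObj U × imObj V)).trans ?_
  simp only [map_zero, add_zero]
  rfl

theorem im_restrLeft (x : U) (y : V) : im (restrLeft f x) ((restrEmb f).1 y) = 0 := by
  refine (form_app f ((x, 0) : imObj U × imObj V) ((0, y) : imObj U × imObj V)).trans ?_
  simp only [map_zero, zero_add]
  rfl

/-- The linear map `U × V → W` with the given components. -/
noncomputable def linOfPair (S : U →L[ℝ] W) (T : V →L[ℝ] W) :
    (imObj U ⊗ imObj V : SymplecticSpace.{u}) →ₗ[ℝ] imObj W :=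
  (LinearMap.coprod S.toLinearMap T.toLinearMap : U × V →ₗ[ℝ] W)

theorem preserves_linOfPair {S : U →L[ℝ] W} {T : V →L[ℝ] W} (hS : IsSymp S) (hT : IsSymp T)
    (h : ∀ x y, im (S x) (T y) = 0) : Preserves (linOfPair S T) := by
  have key : ∀ p q : U × V,
      im (S p.1 + T p.2) (S q.1 + T q.2) = im p.1 q.1 + im p.2 q.2 := fun p q => by
    rw [im_add_left, im_add_right, im_add_right, hS, hT, h, im_swap (T p.2), h]
    ring
  exact fun p q => key p q

theorem continuous_linOfPair :
    @Continuous _ _ _ (moduleTopology ℝ _)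
      fun p : (U →L[ℝ] W) × (V →L[ℝ] W) => linOfPair p.1 p.2 := by
  let _ : TopologicalSpace (U × V →ₗ[ℝ] W) := moduleTopology ℝ _
  have _ : IsModuleTopology ℝ (U × V →ₗ[ℝ] W) := ⟨rfl⟩
  have _ : IsTopologicalAddGroup (U × V →ₗ[ℝ] W) := IsModuleTopology.topologicalAddGroup ℝ _
  have _ : ContinuousSMul ℝ (U × V →ₗ[ℝ] W) := IsModuleTopology.toContinuousSMul ℝ _
  let L : ((U →L[ℝ] W) × (V →L[ℝ] W)) →ₗ[ℝ] (U × V →ₗ[ℝ] W) :=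
    { toFun := fun p => LinearMap.coprod p.1.toLinearMap p.2.toLinearMap
      map_add' := fun p q => by ext <;> simp
      map_smul' := fun c p => by ext <;> simp }
  exact L.continuous_of_finiteDimensional

theorem continuousAt_linOfPair {Z : Type*} [TopologicalSpace Z] {a : Z → (U →L[ℝ] W)}
    {b : Z → (V →L[ℝ] W)} {z : Z} (ha : ContinuousAt a z) (hb : ContinuousAt b z) :
    @ContinuousAt _ _ _ (moduleTopology ℝ _) (fun z => linOfPair (a z) (b z)) z := by
  let _ : TopologicalSpace ((imObj U ⊗ imObj V : SymplecticSpace.{u}) →ₗ[ℝ] imObj W) :=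
    moduleTopology ℝ _
  have h : ContinuousAt (fun p : (U →L[ℝ] W) × (V →L[ℝ] W) => linOfPair p.1 p.2) (a z, b z) :=
    continuous_linOfPair.continuousAt
  exact ContinuousAt.comp (f := fun z => (a z, b z)) h (ha.prodMk hb)

open Classical in
/-- A local section, near the restriction of `f`, of the restriction map. -/
noncomputable def localSection (T : SympEmb V W) : imObj U ⊗ imObj V ⟶ imObj W :=
  if h : ‖1 - complGram (restrLeft f) T.1‖ < 1 then
    homOfPreserves (linOfPair (complSymp (restrLeft f) T.1) T.1)
      (preserves_linOfPair (isSymp_complSymp h) T.2 (im_complSymp _ T.2))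
      (SymplecticSpace.finrank_eq f)
  -- An arbitrary value: only embeddings near `restrEmb f` matter, and they satisfy the inequality.
  else f

theorem eventually_norm_lt_restrLeft :
    ∀ᶠ T : SympEmb V W in nhds (restrEmb f), ‖1 - complGram (restrLeft f) T.1‖ < 1 :=
  continuous_subtype_val.continuousAt.eventually
    (eventually_norm_lt (isSymp_restrLeft f) (im_restrLeft f))

theorem toLin_localSection {T : SympEmb V W} (h : ‖1 - complGram (restrLeft f) T.1‖ < 1) :
    toLin (localSection f T) = linOfPair (complSymp (restrLeft f) T.1) T.1 := by
  rw [localSection, dif_pos h]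
  rfl

theorem restrEmb_localSection {T : SympEmb V W}
    (h : ‖1 - complGram (restrLeft f) T.1‖ < 1) : restrEmb (localSection f T) = T := by
  refine Subtype.ext (ContinuousLinearMap.ext fun x => ?_)
  refine (DFunLike.congr_fun (toLin_localSection f h) ((0, x) : U × V)).trans ?_
  change complSymp (restrLeft f) T.1 0 + T.1 x = T.1 x
  rw [map_zero, zero_add]

theorem continuousAt_localSection : ContinuousAt (localSection f) (restrEmb f) := by
  let _ : TopologicalSpace ((imObj U ⊗ imObj V : SymplecticSpace.{u}) →ₗ[ℝ] imObj W) :=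
    moduleTopology ℝ _
  have hi : Topology.IsInducing (toLin : (imObj U ⊗ imObj V ⟶ imObj W) → _) := ⟨rfl⟩
  rw [hi.continuousAt_iff]
  have h1 : ContinuousAt (fun T : SympEmb V W =>
      linOfPair (complSymp (restrLeft f) T.1) T.1) (restrEmb f) := by
    have h2 : ContinuousAt (fun T : SympEmb V W => complSymp (restrLeft f) T.1) (restrEmb f) :=
      (continuousAt_complSymp (isSymp_restrLeft f) (im_restrLeft f)).comp continuousAt_subtype_val
    exact continuousAt_linOfPair h2 continuousAt_subtype_val
  refine h1.congr ?_
  filter_upwards [eventually_norm_lt_restrLeft f] with T hT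
  exact (toLin_localSection f hT).symm

end LocalSection

variable (V W) in
/-- The morphism spaces of the symplectic bracket construction are the spaces of symplectic
embeddings. -/
noncomputable def homHomeomorph :
    ((⟨imObj V⟩ : SymplecticJ.{u}) ⟶ (⟨imObj W⟩ : SymplecticJ.{u})) ≃ₜ SympEmb V W where
  toEquiv := Equiv.ofBijective (embOfHom V W) bijective_embOfHom
  continuous_toFun := continuous_embOfHom
  continuous_invFun := by
    set e := Equiv.ofBijective (embOfHom V W) bijective_embOfHom with he
    rw [continuous_iff_continuousAt]
    intro T
    obtain ⟨p, rfl⟩ := e.surjective T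
    obtain ⟨U, f, rfl⟩ := exists_cls_imObj p
    -- Near `restrEmb f` the inverse bijection agrees with the class of the local section, which is
    -- continuous at that point.
    have hs : ContinuousAt (fun T : SympEmb V W => proj (⟨imObj V⟩ : SymplecticJ.{u})
        (⟨imObj W⟩ : SymplecticJ.{u}) ⟨imObj U, localSection f T⟩) (restrEmb f) := by
      refine ((isOpenQuotientMap_proj _ _).continuous.comp continuous_sigmaMk).continuousAt.comp
        (continuousAt_localSection f)
    refine hs.congr ?_
    filter_upwards [eventually_norm_lt_restrLeft f] with T hT
    refine e.injective ?_
    refine Eq.trans ?_ (e.apply_symm_apply T).symm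
    exact restrEmb_localSection f hT

end HermitianSpace

/-! ### Morphism spaces of the unitary bracket -/

namespace HermitianSpace

open SymplecticSpace ImForm QuillenBracket

variable {U U' V W : HermitianSpace.{u}}

/-- A complex linear symplectic isomorphism is a linear isometric isomorphism. -/
noncomputable def homOfIm (g : imObj V ⟶ imObj W)
    (hg : IsComplex (clmOfLin (toLin g))) : V ⟶ W :=
  ofIso
    { toFun := fun x : V => toEquiv g x
      map_add' := (toEquiv g).map_add
      map_smul' := hg.map_smul
      invFun := (toEquiv g).symm
      left_inv := (toEquiv g).left_inv
      right_inv := (toEquiv g).right_inv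
      norm_map' := IsSymp.norm_map (T := clmOfLin (toLin g)) (form_toEquiv g) hg }

theorem finrank_eq (f : V ⟶ W) : Module.finrank ℂ V = Module.finrank ℂ W :=
  (toIso f).toLinearEquiv.finrank_eq

instance compactSpace_hom (V W : HermitianSpace.{u}) : CompactSpace (V ⟶ W) := by
  rcases isEmpty_or_nonempty (V ⟶ W) with h | ⟨⟨f₀⟩⟩
  · infer_instance
  have hi : Topology.IsInducing (toCLM : (V ⟶ W) → (V →L[ℂ] W)) := ⟨rfl⟩
  have hr : Set.range (toCLM : (V ⟶ W) → (V →L[ℂ] W)) = {T | ∀ x, ‖T x‖ = ‖x‖} := by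
    ext T
    constructor
    · rintro ⟨f, rfl⟩ x
      exact (toIso f).norm_map x
    · intro hT
      -- The isomorphism f₀ equates the dimensions, so every isometric embedding is onto and the
      -- range is cut out by a closed condition.
      let S : V →ₗᵢ[ℂ] W := ⟨T.toLinearMap, hT⟩
      exact ⟨ofIso (S.toLinearIsometryEquiv (finrank_eq f₀)), ContinuousLinearMap.ext fun _ => rfl⟩
  have hc : IsClosed {T : V →L[ℂ] W | ∀ x, ‖T x‖ = ‖x‖} := by
    rw [Set.ofPred_forall]
    exact isClosed_iInter fun x => isClosed_eq (by fun_prop) continuous_const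
  have hb : {T : V →L[ℂ] W | ∀ x, ‖T x‖ = ‖x‖} ⊆ Metric.closedBall 0 1 := fun T hT => by
    rw [mem_closedBall_zero_iff]
    exact T.opNorm_le_bound zero_le_one fun x => by rw [hT, one_mul]
  have _ : ProperSpace (V →L[ℂ] W) := FiniteDimensional.proper ℂ _
  rw [← isCompact_univ_iff, hi.isCompact_iff, Set.image_univ, hr]
  exact (isCompact_closedBall _ _).of_isClosed_subset hc hb

theorem finrank_tensor (X A : HermitianSpace.{u}) :
    Module.finrank ℂ (X ⊗ A : HermitianSpace.{u}) = Module.finrank ℂ X + Module.finrank ℂ A :=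
  ((WithLp.linearEquiv 2 ℂ (X × A)).finrank_eq).trans Module.finrank_prod

/-- All X that occur have the same dimension and so are isometric; a single compact space of
isomorphisms X ⊕ A → B therefore surjects onto the morphism space. -/
instance compactSpace_hom_bracket (A B : UnitaryJ.{u}) : CompactSpace (A ⟶ B) := by
  rcases isEmpty_or_nonempty (A ⟶ B) with h | ⟨⟨⟨X, f⟩⟩⟩
  · infer_instance
  have hc : Continuous fun f : X ⊗ A.ob ⟶ B.ob => proj A B ⟨X, f⟩ :=
    (isOpenQuotientMap_proj A B).continuous.comp continuous_sigmaMk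
  have hs : Function.Surjective fun f : X ⊗ A.ob ⟶ B.ob => proj A B ⟨X, f⟩ := by
    rintro ⟨X', f'⟩
    have hd : Module.finrank ℂ X = Module.finrank ℂ X' := by
      have h := (finrank_eq f).trans (finrank_eq f').symm
      rw [finrank_tensor, finrank_tensor] at h
      exact Nat.add_right_cancel h
    let g : X ⟶ X' := ofIso
      ((stdOrthonormalBasis ℂ X).equiv (stdOrthonormalBasis ℂ X') (finCongr hd))
    exact ⟨g ▷ A.ob ≫ f', cls_eq g rfl⟩
  exact hs.compactSpace hc

/-- The symplectic embedding underlying a morphism of the unitary bracket construction. -/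
noncomputable def embOfUnitary (A B : UnitaryJ.{u}) (p : A ⟶ B) : SympEmb A.ob B.ob :=
  homHomeomorph A.ob B.ob (homMap imJ A B p)

theorem embOfUnitary_cls {A B : UnitaryJ.{u}} {X : HermitianSpace.{u}} (f : X ⊗ A.ob ⟶ B.ob)
    (x : A.ob) : (embOfUnitary A B (cls X f)).1 x = toIso f (WithLp.toLp 2 ((0, x) : X × A.ob)) :=
  rfl

theorem continuous_embOfUnitary (A B : UnitaryJ.{u}) : Continuous (embOfUnitary A B) :=
  (homHomeomorph A.ob B.ob).continuous.comp (homMap imJ A B).continuous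

theorem isComplex_embOfUnitary {A B : UnitaryJ.{u}} (p : A ⟶ B) :
    IsComplex (embOfUnitary A B p).1 := by
  obtain ⟨X, f⟩ := p
  intro x
  refine (embOfUnitary_cls f _).trans ?_
  refine Eq.trans ?_ (congrArg (Complex.I • ·) (embOfUnitary_cls f x).symm)
  change _ = Complex.I • toIso f _
  rw [← map_smul]
  congr 1
  refine WithLp.ofLp_injective 2 (Prod.ext ?_ rfl)
  exact (smul_zero Complex.I).symm

/-- The symplectic isomorphism g of complements satisfies f' ∘ (g ⊕ A) = f with f and f' complex
linear and f' injective. So g is complex linear, hence unitary, and already identifies the classes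
in J^U. -/
theorem injective_embOfUnitary (A B : UnitaryJ.{u}) : Function.Injective (embOfUnitary A B) := by
  rintro ⟨X, f⟩ ⟨X', f'⟩ h
  have h' := (homHomeomorph A.ob B.ob).injective h
  obtain ⟨g, hg⟩ : ∃ g : imObj X ⟶ imObj X', g ▷ imObj A.ob ≫ (preMap imFunctor ⟨X', f'⟩).2 =
      (preMap imFunctor ⟨X, f⟩).2 := _root_.Quotient.exact h'
  let T : X →L[ℝ] X' := clmOfLin (toLin g)
  have key : ∀ (x : X) (a : A.ob), toIso f' (WithLp.toLp 2 (T x, a)) =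
      toIso f (WithLp.toLp 2 (x, a)) := fun x a =>
    DFunLike.congr_fun (congrArg toEquiv hg) ((x, a) : X × A.ob)
  have hc : IsComplex T := by
    intro x
    have hinj := (toIso f').injective.comp (WithLp.toLp_injective 2 (V := X' × A.ob))
    have hI : ∀ {Z : HermitianSpace.{u}} (k : Z ⊗ A.ob ⟶ B.ob) (z : Z),
        toIso k (WithLp.toLp 2 (Complex.I • z, (0 : A.ob))) =
          Complex.I • toIso k (WithLp.toLp 2 (z, (0 : A.ob))) := by
      intro Z k z
      rw [← map_smul]
      congr 1
      refine WithLp.ofLp_injective 2 (Prod.ext rfl ?_)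
      exact (smul_zero Complex.I).symm
    have h1 : toIso f' (WithLp.toLp 2 (T (Complex.I • x), (0 : A.ob))) =
        toIso f' (WithLp.toLp 2 (Complex.I • T x, (0 : A.ob))) := by
      rw [key, hI, hI, key]
    exact congrArg Prod.fst (hinj h1)
  refine cls_eq (homOfIm g hc) (hom_ext fun p => ?_)
  exact key (WithLp.ofLp p).1 (WithLp.ofLp p).2

/-- Such a T is a complex isometric embedding, and the orthogonal complement of its range serves as
X. -/
theorem exists_embOfUnitary_eq {A B : UnitaryJ.{u}} (T : SympEmb A.ob B.ob)
    (hT : IsComplex T.1) : ∃ p, embOfUnitary A B p = T := by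
  let S : A.ob →ₗᵢ[ℂ] B.ob :=
    { toFun := T.1
      map_add' := T.1.map_add
      map_smul' := hT.map_smul
      norm_map' := T.2.norm_map hT }
  let R := LinearMap.range S.toLinearMap
  let X : HermitianSpace.{u} := ⟨Rᗮ⟩
  let f : WithLp 2 (Rᗮ × A.ob) →ₗᵢ[ℂ] B.ob :=
    { toLinearMap := (LinearMap.coprod Rᗮ.subtype S.toLinearMap) ∘ₗ
        (WithLp.linearEquiv 2 ℂ (Rᗮ × A.ob)).toLinearMap
      norm_map' := fun p => by
        have h0 : inner ℂ (p.fst : B.ob) (S p.snd) = 0 :=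
          (Submodule.mem_orthogonal' R _).1 p.fst.2 _ ⟨p.snd, rfl⟩
        have h1 := norm_add_sq_eq_norm_sq_add_norm_sq_of_inner_eq_zero (𝕜 := ℂ) _ _ h0
        refine (pow_left_inj₀ (norm_nonneg _) (norm_nonneg _) two_ne_zero).1 ?_
        rw [WithLp.prod_norm_sq_eq_of_L2, ← S.norm_map p.snd, sq, sq, sq]
        exact h1 }
  have hd : Module.finrank ℂ (WithLp 2 (Rᗮ × A.ob)) = Module.finrank ℂ B.ob := by
    rw [(WithLp.linearEquiv 2 ℂ (Rᗮ × A.ob)).finrank_eq, Module.finrank_prod, add_comm,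
      ← LinearMap.finrank_range_of_inj S.injective]
    exact R.finrank_add_finrank_orthogonal
  refine ⟨cls X (ofIso (V := X ⊗ A.ob) (f.toLinearIsometryEquiv hd)), Subtype.ext ?_⟩
  ext x
  refine (embOfUnitary_cls _ x).trans ?_
  change (0 : B.ob) + T.1 x = T.1 x
  exact zero_add _

/-- `Im` is a weak homotopy equivalence on morphism spaces. -/
theorem isWeakHomotopyEquiv_homMap_imJ (A B : UnitaryJ.{u}) :
    IsWeakHomotopyEquiv (homMap (imJ : UnitaryJ.{u} ⥤ SymplecticJ.{u}) A B) := by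
  let e := homHomeomorph A.ob B.ob
  -- A continuous injection from a compact space to a Hausdorff space.
  have hι : Topology.IsClosedEmbedding (embOfUnitary A B) :=
    (continuous_embOfUnitary A B).isClosedEmbedding (injective_embOfUnitary A B)
  have hsq : ∀ s : unitInterval, (s : ℝ) ^ 2 ≤ 1 := fun s => pow_le_one₀ s.2.1 s.2.2
  let D : unitInterval × SympEmb A.ob B.ob → SympEmb A.ob B.ob :=
    fun q => ⟨deform q.1 q.2.1, isSymp_deform (hsq q.1) q.2.2⟩
  have hD : Continuous D := by
    refine Continuous.subtype_mk (continuous_iff_continuousAt.2 fun q => ?_) _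
    have h : Continuous fun q : unitInterval × SympEmb A.ob B.ob => ((q.1 : ℝ), q.2.1) := by
      fun_prop
    exact ContinuousAt.comp (f := fun q : unitInterval × SympEmb A.ob B.ob => ((q.1 : ℝ), q.2.1))
      (continuousAt_deform (hsq q.1) q.2.2) h.continuousAt
  have hex : ∀ T : SympEmb A.ob B.ob, ∃ p, embOfUnitary A B p = D (0, T) := fun T =>
    exists_embOfUnitary_eq _ (isComplex_deform_zero T.1)
  choose ρ hρ using hex
  -- The topology of J^U is induced from the embeddings, so continuity of the lift ρ follows from
  -- that of the deformation at time 0.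
  have hρc : Continuous ρ := by
    rw [hι.isInducing.continuous_iff]
    exact (hD.comp (Continuous.prodMk_right 0)).congr fun T => (hρ T).symm
  have hfix : ∀ t p, D (t, embOfUnitary A B p) = embOfUnitary A B p := fun t p =>
    Subtype.ext (deform_of_isComplex (embOfUnitary A B p).2 (isComplex_embOfUnitary p) t)
  refine .of_deformationRetract _ ⟨fun q => ρ (e q), hρc.comp e.continuous⟩ (fun p => ?_)
    ⟨fun q => e.symm (D (q.1, e q.2)), ?_⟩ (fun q => ?_) (fun q => ?_) (fun t p => ?_)
  · exact hι.injective ((hρ _).trans (hfix 0 p))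
  · exact e.symm.continuous.comp (hD.comp (continuous_fst.prodMk (e.continuous.comp continuous_snd)))
  · exact e.symm_apply_eq.2 (hρ (e q)).symm
  · exact e.symm_apply_eq.2 (Subtype.ext (deform_one (e q).2))
  · exact e.symm_apply_eq.2 (hfix t p)

end HermitianSpace

/-! ### Essential surjectivity -/

namespace QuillenBracket

variable {G : Type u} [Groupoid.{v} G] [MonoidalCategory G]

/-- The canonical functor from a monoidal groupoid to its bracket construction. -/
def incl (G : Type u) [Groupoid.{v} G] [MonoidalCategory G] : G ⥤ QuillenBracket G where
  obj A := ⟨A⟩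
  map {A B} f := cls (A := ⟨A⟩) (B := ⟨B⟩) (𝟙_ G) ((λ_ A).hom ≫ f)
  map_id A := by simp; rfl
  map_comp {A B C} f g := Eq.symm (cls_eq (λ_ (𝟙_ G)).hom (by simp))

end QuillenBracket

theorem essSurj_piZero_imJ : (piZeroFunctor (imJ : UnitaryJ.{u} ⥤ SymplecticJ.{u})).EssSurj where
  mem_essImage Y := by
    obtain ⟨V, ⟨g⟩⟩ := SymplecticSpace.exists_hom_imObj Y.as.ob
    -- The isomorphism exists already in the symplectic groupoid and is carried to J^S and then to
    -- π₀ J^S.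
    let i : HermitianSpace.imObj V ≅ Y.as.ob := ⟨g, inv g, by simp, by simp⟩
    exact ⟨⟨⟨V⟩⟩, ⟨(CategoryTheory.Quotient.functor _).mapIso
      ((QuillenBracket.incl SymplecticSpace.{u}).mapIso i)⟩⟩

theorem mainTheorem3 : IsDwyerKanEquivalence (imJ : UnitaryJ.{u} ⥤ SymplecticJ.{u}) where
  fullyFaithful := HermitianSpace.isWeakHomotopyEquiv_homMap_imJ
  essSurj := essSurj_piZero_imJ
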